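/- Let $\mathcal X$ be a measurable space and let $\mathbf Q$ be a probability distribution on $\mathcal X\times\{0,1\}$ with $\gamma_s=\mathbf Q(\mathcal X\times\{s\})>0$ for $s\in\{0,1\}$; let $\mathbf Q^s$ be the conditional distribution of $x$ given $s$. Let $N\ge 2$ and $a^{(k)}=(k-1/2)/N$ for $k\in\{1,\dots,N\}$. Consider the following repeated game. At each round $t\ge 1$, contexts $(x_t,s_t)\sim\mathbf Q$ are drawn independently of the past. The Player observes $x_t$ and draws $k_t\in\{1,\dots,N\}$ from a mixed action that depends measurably on $x_t$ and on the payoff vectors and contexts $(x_{t'},s_{t'})$ of the past rounds. Simultaneously, Nature, who is unaware of $s_t$ (monitoring $G(x,s)=x$), observes $x_t$ and draws $b_t\in\{0,1\}$ from a mixed action that depends measurably on $x_t$ and on the full past history $(k_{t'},b_{t'},x_{t'},s_{t'})_{t'<t}$. Given the past and the contexts of the round, the two draws are independent. The payoff vector is $\mathbf m(k,b,s)=(\mathbf m_{\rm gr\text{-}cal}(k,b,s),\mathbf m_{\rm DP}(k,s))\in\mathbb R^{2N}\times\mathbb R^2$, where $$\mathbf m_{\rm gr\text{-}cal}(k,b,s)=\Bigl(\tfrac{(a^{(k)}-b)\,\mathbf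 1_{k=k'}\mathbf 1_{s=s'}}{\gamma_{s'}}\Bigr)_{s'\in\{0,1\},\,1\le k'\le N},\qquad \mathbf m_{\rm DP}(k,s)=\Bigl(\tfrac{a^{(k)}\mathbf 1_{s=0}}{\gamma_0},\tfrac{a^{(k)}\mathbf 1_{s=1}}{\gamma_1}\Bigr).$$ A pair $(\varepsilon,\delta)$ of nonnegative numbers is achievable if there is a strategy of the Player (for this $\mathbf Q$) such that, for all strategies of Nature, the Euclidean distance of $\frac1T\sum_{t=1}^T\mathbf m(k_t,b_t,s_t)$ to $\{\mathbf v\in\mathbb R^{2N}:\|\mathbf v\|_1\le\varepsilon\}\times\{(u,v)\in\mathbb R^2:|u-v|\le\delta\}$ tends to $0$ almost surely as $T\to\infty$. Let $\varepsilon^\star(\delta)$ denote the smallest $\varepsilon\ge0$ such that $(\varepsilon,\delta)$ is achievable, and let $\mathrm{TV}(\mathbf Q^0,\mathbf Q^1)=\sup_E|\mathbf Q^0(E)-\mathbf Q^1(E)|$, the supremum being over measurable $E\subseteq\mathcal X$. Then for every $\tau\in[0,1]$, with $\delta_\tau=\tau\cdot\mathrm{TV}(\mathbf Q^0,\mathbf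 Q^1)$, the smallest achievable $\varepsilon^\star(\delta_\tau)$ exists and $$(1-\tau)\,\mathrm{TV}(\mathbf Q^0,\mathbf Q^1)\ \le\ \varepsilon^\star(\delta_\tau)\ \le\ (1-\tau)\,\mathrm{TV}(\mathbf Q^0,\mathbf Q^1)+\frac1N .$$ In particular (taking $\tau=1$), group-wise $1/N$-calibration is always possible: the pair $(1/N,\mathrm{TV}(\mathbf Q^0,\mathbf Q^1))$ is achievable. -/

import Mathlib

open MeasureTheory ProbabilityTheory Filter Topology

/-! ## The repeated game with stochastic contexts -/

/-- What happens at one round: the contexts `(x, s)`, and the actions `(a, b)` of the Player and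
of Nature. -/
abbrev Round (X S A B : Type*) : Type _ := (X × S) × (A × B)

/-- What the Player gets to know about a past round: the vector payoff and the contexts. -/
abbrev Obs (X S ι : Type*) : Type _ := EuclideanSpace ℝ ι × (X × S)

/-- The data of the game: the joint law of the contexts `(x, s)`, the observation operator of
Nature, and the vector payoff function. -/
structure ContextGame (X S A B Y ι : Type*) [MeasurableSpace X] [MeasurableSpace S]
    [MeasurableSpace A] [MeasurableSpace B] [MeasurableSpace Y] where
  /-- the joint distribution of the contexts -/
  law : Measure (X × S)
  /-- it is a probability distribution -/
  isProb : IsProbabilityMeasure law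
  /-- the observation operator of Nature -/
  monitor : X × S → Y
  /-- it is measurable -/
  measurable_monitor : Measurable monitor
  /-- the vector payoff function -/
  payoff : Round X S A B → EuclideanSpace ℝ ι
  /-- it is measurable -/
  measurable_payoff : Measurable payoff

attribute [instance] ContextGame.isProb

/-- A strategy of the Player. Rounds are numbered `0, 1, 2, …`. In round `0` the Player picks a
measurable family of mixed actions indexed by the non-sensitive context `x`. In round `n + 1` this
family may depend measurably on what the Player observed in the rounds `0, …, n`. -/
structure PlayerStrategy (X S A ι : Type*) [MeasurableSpace X] [MeasurableSpace S]
    [MeasurableSpace A] where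
  /-- the mixed actions of the first round -/
  first : Kernel X A
  /-- the mixed actions of the later rounds -/
  next : (n : ℕ) → Kernel (((_ : Finset.Iic n) → Obs X S ι) × X) A
  /-- probability distributions -/
  isMarkov_first : IsMarkovKernel first
  /-- probability distributions -/
  isMarkov_next : ∀ n, IsMarkovKernel (next n)

attribute [instance] PlayerStrategy.isMarkov_first PlayerStrategy.isMarkov_next

/-- A strategy of Nature: measurable families of mixed actions indexed by Nature's current
observation, which may depend measurably on the full history of the past rounds. -/
structure NatureStrategy (X S A B Y : Type*) [MeasurableSpace X] [MeasurableSpace S]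
    [MeasurableSpace A] [MeasurableSpace B] [MeasurableSpace Y] where
  /-- the mixed actions of the first round -/
  first : Kernel Y B
  /-- the mixed actions of the later rounds -/
  next : (n : ℕ) → Kernel (((_ : Finset.Iic n) → Round X S A B) × Y) B
  /-- probability distributions -/
  isMarkov_first : IsMarkovKernel first
  /-- probability distributions -/
  isMarkov_next : ∀ n, IsMarkovKernel (next n)

attribute [instance] NatureStrategy.isMarkov_first NatureStrategy.isMarkov_next

namespace ContextGame

variable {X S A B Y ι : Type*} [MeasurableSpace X] [MeasurableSpace S]
  [MeasurableSpace A] [MeasurableSpace B] [MeasurableSpace Y]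

/-- The Player's information in a full history. -/
def obsHist (g : ContextGame X S A B Y ι) (n : ℕ)
    (h : (_ : Finset.Iic n) → Round X S A B) : (_ : Finset.Iic n) → Obs X S ι :=
  fun i => (g.payoff (h i), (h i).1)

lemma measurable_obsHist (g : ContextGame X S A B Y ι) (n : ℕ) :
    Measurable (g.obsHist n) :=
  measurable_pi_lambda _ fun i =>
    (g.measurable_payoff.comp (measurable_pi_apply i)).prodMk
      (measurable_fst.comp (measurable_pi_apply i))

/-- The law of the first round: the contexts are drawn, and then, given the contexts, the two
actions are drawn independently of each other. -/
noncomputable def roundZero (g : ContextGame X S A B Y ι) (σ : PlayerStrategy X S A ι)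
    (ν : NatureStrategy X S A B Y) : Measure (Round X S A B) :=
  g.law ⊗ₘ ((σ.first.comap Prod.fst measurable_fst) ×ₖ
    (ν.first.comap g.monitor g.measurable_monitor))

/-- The conditional law of round `n + 1` given the rounds `0, …, n`: the contexts are drawn
independently of the past, and then, given the past and the contexts, the two actions are drawn
independently of each other. -/
noncomputable def roundSucc (g : ContextGame X S A B Y ι) (σ : PlayerStrategy X S A ι)
    (ν : NatureStrategy X S A B Y) (n : ℕ) :
    Kernel ((_ : Finset.Iic n) → Round X S A B) (Round X S A B) :=
  (Kernel.const _ g.law) ⊗ₖ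
    (((σ.next n).comap
        (fun p : ((_ : Finset.Iic n) → Round X S A B) × (X × S) => (g.obsHist n p.1, p.2.1))
        (((g.measurable_obsHist n).comp measurable_fst).prodMk
          (measurable_fst.comp measurable_snd))) ×ₖ
      ((ν.next n).comap
        (fun p : ((_ : Finset.Iic n) → Round X S A B) × (X × S) => (p.1, g.monitor p.2))
        (measurable_fst.prodMk (g.measurable_monitor.comp measurable_snd))))

instance (g : ContextGame X S A B Y ι) (σ : PlayerStrategy X S A ι)
    (ν : NatureStrategy X S A B Y) : IsProbabilityMeasure (g.roundZero σ ν) := by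
  unfold roundZero; infer_instance

instance (g : ContextGame X S A B Y ι) (σ : PlayerStrategy X S A ι)
    (ν : NatureStrategy X S A B Y) (n : ℕ) : IsMarkovKernel (g.roundSucc σ ν n) := by
  unfold roundSucc; infer_instance

/-- The law of the infinite play induced by a pair of strategies. -/
noncomputable def playLaw (g : ContextGame X S A B Y ι) (σ : PlayerStrategy X S A ι)
    (ν : NatureStrategy X S A B Y) : Measure (ℕ → Round X S A B) :=
  Kernel.trajMeasure (X := fun _ => Round X S A B) (g.roundZero σ ν) (g.roundSucc σ ν)

/-- The average vector payoff over the first `T` rounds. -/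
noncomputable def avgPayoff (g : ContextGame X S A B Y ι) (T : ℕ) (ω : ℕ → Round X S A B) :
    EuclideanSpace ℝ ι :=
  (T : ℝ)⁻¹ • ∑ t ∈ Finset.range T, g.payoff (ω t)

/-- A (nonempty closed) target set `C` is approachable when the Player has a strategy such that,
for all strategies of Nature, the distance of the average payoff to `C` tends to `0` almost
surely. -/
def Approachable [Fintype ι] (g : ContextGame X S A B Y ι) (C : Set (EuclideanSpace ℝ ι)) :
    Prop :=
  ∃ σ : PlayerStrategy X S A ι, ∀ ν : NatureStrategy X S A B Y,
    ∀ᵐ ω ∂(g.playLaw σ ν),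
      Tendsto (fun T : ℕ => Metric.infDist (g.avgPayoff T ω) C) atTop (𝓝 0)

end ContextGame

/-! ## Group-wise calibration under a demographic parity constraint -/

section Calibration

variable {X : Type*} [MeasurableSpace X]

/-- Total variation distance: the supremum over measurable `E` of `|P E - R E|`. -/
noncomputable def tvDist (P R : Measure X) : ℝ :=
  ⨆ E : {E : Set X // MeasurableSet E}, |P.real E.1 - R.real E.1|

/-- The probability `γ_s` of the sensitive context `s`. -/
noncomputable def groupProb (Q : Measure (X × Fin 2)) (s : Fin 2) : ℝ :=
  Q.real (Prod.snd ⁻¹' {s})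

/-- The conditional distribution of the non-sensitive context given the sensitive context `s`. -/
noncomputable def groupLaw (Q : Measure (X × Fin 2)) (s : Fin 2) : Measure X :=
  (ProbabilityTheory.cond Q (Prod.snd ⁻¹' {s})).map Prod.fst

/-- The forecast grid: `Fin N` starts at `0`, so these are the points `(k - 1/2) / N` for
`k = 1, …, N`. -/
noncomputable def gridPoint (N : ℕ) (k : Fin N) : ℝ := (((k : ℕ) : ℝ) + 1 / 2) / N

/-- The index set of the coordinates: one for each (group, forecast) for the calibration part,
and one for each group for the demographic parity part. -/
abbrev CalIdx (N : ℕ) : Type := (Fin 2 × Fin N) ⊕ Fin 2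

/-- The vector payoff as a function of the group, the forecast and the outcome. -/
noncomputable def calDPVec (Q : Measure (X × Fin 2)) (N : ℕ) (s : Fin 2) (k : Fin N) (b : Fin 2) :
    EuclideanSpace ℝ (CalIdx N) :=
  WithLp.toLp 2 (Sum.elim
    (fun j : Fin 2 × Fin N =>
      if s = j.1 ∧ k = j.2 then (gridPoint N k - ((b : ℕ) : ℝ)) / groupProb Q j.1 else 0)
    (fun s' : Fin 2 => if s = s' then gridPoint N k / groupProb Q s' else 0))

lemma measurable_calDPVec (Q : Measure (X × Fin 2)) (N : ℕ) :
    Measurable (fun r : Round X (Fin 2) (Fin N) (Fin 2) =>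
      calDPVec Q N r.1.2 r.2.1 r.2.2) :=
  (measurable_of_countable
    (fun p : Fin 2 × (Fin N × Fin 2) => calDPVec Q N p.1 p.2.1 p.2.2)).comp
    ((measurable_snd.comp measurable_fst).prodMk measurable_snd)

/-- The game of group-wise calibration and demographic parity, with contexts of law `Q` and
monitoring `G` of Nature. The Player picks a forecast in the grid, Nature picks an outcome in
`{0, 1}`. -/
noncomputable def calDPGame (Q : Measure (X × Fin 2)) [IsProbabilityMeasure Q] (N : ℕ)
    {Y : Type*} [MeasurableSpace Y] (G : X × Fin 2 → Y) (hG : Measurable G) :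
    ContextGame X (Fin 2) (Fin N) (Fin 2) Y (CalIdx N) where
  law := Q
  isProb := inferInstance
  monitor := G
  measurable_monitor := hG
  payoff := fun r => calDPVec Q N r.1.2 r.2.1 r.2.2
  measurable_payoff := measurable_calDPVec Q N

/-- The target set: the calibration part has `ℓ¹`-norm at most `ε`, and the two coordinates of the
demographic parity part differ by at most `δ`. -/
def calDPTarget (N : ℕ) (ε δ : ℝ) : Set (EuclideanSpace ℝ (CalIdx N)) :=
  {v | ∑ j : Fin 2 × Fin N, |v (Sum.inl j)| ≤ ε ∧ |v (Sum.inr 0) - v (Sum.inr 1)| ≤ δ}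

/-- The pair `(ε, δ)` of nonnegative numbers is achievable. -/
def Achievable (Q : Measure (X × Fin 2)) [IsProbabilityMeasure Q] (N : ℕ)
    {Y : Type*} [MeasurableSpace Y] (G : X × Fin 2 → Y) (hG : Measurable G) (ε δ : ℝ) : Prop :=
  0 ≤ ε ∧ 0 ≤ δ ∧ (calDPGame Q N G hG).Approachable (calDPTarget N ε δ)

/-- The smallest calibration error that is achievable at the violation level `δ` of demographic
parity. -/
noncomputable def epsStar (Q : Measure (X × Fin 2)) [IsProbabilityMeasure Q] (N : ℕ)
    {Y : Type*} [MeasurableSpace Y] (G : X × Fin 2 → Y) (hG : Measurable G) (δ : ℝ) : ℝ :=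
  sInf {ε : ℝ | Achievable Q N G hG ε δ}

end Calibration

/-! ## Finite zero-sum games -/

section FiniteGame

variable {A B : Type*} [Fintype A] [Fintype B]

/-! The proof has two layers: a dual characterisation of approachability, then a computation of the
dual condition.

Since Nature sees only `x`, neither current mixed action depends on the current `s`, which can be
averaged out under its conditional law given `x`. In a direction `u` this leaves a finite zero-sum
game at each `x`; let V(u) be the integral over `x` of its value. A closed convex set containing 0
is approachable iff V(u) never exceeds its support function at `u`. If so, the Player plays almost
optimally against the direction from the projection of the average payoff to that average, and the
squared distance obeys Blackwell's recursion (`approachable_of_expectedValue_le`). Conversely,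
Nature secures V(u) round by round (`expectedValue_le_of_approachable`). Both directions use a
one-sided law of large numbers from exponential moments and Borel-Cantelli
(`ae_forall_eventually_partial_sum_le`).

The target's support function is finite only when the two parity coordinates of `u` are opposite,
say w and -w; it is then ε Λ + δ |w|, with Λ the largest absolute calibration coordinate. Hence
`achievable_iff`, a family of non-strict inequalities affine in ε, so a smallest ε exists.

Lower bound (`tvDist_le_of_calDPDual`): for calibration coordinates -1, 1 and parity coordinates 1,
-1 on groups 0, 1, the forecast cancels from the payoff. Nature plays the indicator of a set E and
obtains Q⁰(E) - Q¹(E), so TV ≤ ε + δ.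

Upper bound (`calDPDual_of_mem_Icc`): let q(x) be the mean of an almost optimal action of Nature.
Rounding q(x) to the grid bounds V(u) by Λ/N + TV |w|. A constant forecast near the mean of q over
group 0 cancels the parity terms and gives (TV + 1/N) Λ. Weighting these two bounds by τ and 1 - τ
gives the dual condition. -/

lemma sum_mul_le_of_mem_stdSimplex {p f : A → ℝ} (hp : p ∈ stdSimplex ℝ A) {c : ℝ}
    (h : ∀ a, f a ≤ c) : ∑ a, p a * f a ≤ c := by
  calc ∑ a, p a * f a ≤ ∑ a, p a * c :=
        Finset.sum_le_sum fun a _ => mul_le_mul_of_nonneg_left (h a) (hp.1 a)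
    _ = c := by rw [← Finset.sum_mul, hp.2, one_mul]

lemma le_sum_mul_of_mem_stdSimplex {p f : A → ℝ} (hp : p ∈ stdSimplex ℝ A) {c : ℝ}
    (h : ∀ a, c ≤ f a) : c ≤ ∑ a, p a * f a := by
  calc c = ∑ a, p a * c := by rw [← Finset.sum_mul, hp.2, one_mul]
    _ ≤ ∑ a, p a * f a :=
        Finset.sum_le_sum fun a _ => mul_le_mul_of_nonneg_left (h a) (hp.1 a)

lemma sum_sum_swap_mul (p : A → ℝ) (q : B → ℝ) (M : A → B → ℝ) :
    ∑ a, p a * ∑ b, q b * M a b = ∑ b, q b * ∑ a, p a * M a b := by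
  simp only [Finset.mul_sum]
  rw [Finset.sum_comm]
  exact Finset.sum_congr rfl fun _ _ => Finset.sum_congr rfl fun _ _ => by ring

variable [Nonempty A] [Nonempty B]

lemma exists_finite_game_value (M : A → B → ℝ) :
    ∃ v : ℝ, (∃ p ∈ stdSimplex ℝ A, ∀ b, ∑ a, p a * M a b ≤ v) ∧
      ∃ q ∈ stdSimplex ℝ B, ∀ a, v ≤ ∑ b, q b * M a b := by
  classical
  let f : (A → ℝ) → (B → ℝ) → ℝ := fun p q => ∑ a, ∑ b, p a * (q b * M a b)
  have hneA : (stdSimplex ℝ A).Nonempty := ⟨_, single_mem_stdSimplex ℝ (Classical.arbitrary A)⟩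
  have hneB : (stdSimplex ℝ B).Nonempty := ⟨_, single_mem_stdSimplex ℝ (Classical.arbitrary B)⟩
  have hl : ∀ q, IsLinearMap ℝ (fun p => f p q) := fun q =>
    ⟨fun x y => by simp [f, add_mul, Finset.sum_add_distrib],
     fun c x => by simp [f, Finset.mul_sum, mul_assoc]⟩
  have hr : ∀ p, IsLinearMap ℝ (fun q => f p q) := fun p =>
    ⟨fun x y => by simp [f, add_mul, mul_add, Finset.sum_add_distrib],
     fun c x => by
      simp only [f, Finset.mul_sum, Pi.smul_apply, smul_eq_mul]
      refine Finset.sum_congr rfl fun a _ => Finset.sum_congr rfl fun b _ => by ring⟩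
  have hc1 : ∀ q, Continuous (fun p => f p q) := fun q => by fun_prop
  have hc2 : ∀ p, Continuous (fun q => f p q) := fun q => by fun_prop
  obtain ⟨p, hp, q, hq, h⟩ := Sion.exists_isSaddlePointOn (X := stdSimplex ℝ A)
    (Y := stdSimplex ℝ B) (f := f) hneA (convex_stdSimplex ℝ A) (isCompact_stdSimplex ℝ A)
    (fun y _ => (hc1 y).lowerSemicontinuous.lowerSemicontinuousOn _)
    (fun y _ => ((hl y).mk' _).convexOn (convex_stdSimplex ℝ A) |>.quasiconvexOn)
    (convex_stdSimplex ℝ B) hneB (isCompact_stdSimplex ℝ B)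
    (fun y _ => (hc2 y).upperSemicontinuous.upperSemicontinuousOn _)
    (fun y _ => ((hr y).mk' _).concaveOn (convex_stdSimplex ℝ B) |>.quasiconcaveOn)
  refine ⟨f p q, ⟨p, hp, fun b => ?_⟩, q, hq, fun a => ?_⟩
  -- Testing the saddle point against vertices of the simplices gives the bounds for pure actions.
  · have := h p hp _ (single_mem_stdSimplex ℝ b)
    simpa [f, Pi.single_apply] using this
  · have := h _ (single_mem_stdSimplex ℝ a) q hq
    simpa [f, Pi.single_apply] using this

/-- The value of a finite zero-sum game whose row player minimises. -/
noncomputable def gameValue (M : A → B → ℝ) : ℝ := (exists_finite_game_value M).choose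

lemma exists_row_optimal (M : A → B → ℝ) :
    ∃ p ∈ stdSimplex ℝ A, ∀ b, ∑ a, p a * M a b ≤ gameValue M :=
  (exists_finite_game_value M).choose_spec.1

lemma exists_column_optimal (M : A → B → ℝ) :
    ∃ q ∈ stdSimplex ℝ B, ∀ a, gameValue M ≤ ∑ b, q b * M a b :=
  (exists_finite_game_value M).choose_spec.2

lemma le_gameValue {M : A → B → ℝ} {c : ℝ} {q : B → ℝ} (hq : q ∈ stdSimplex ℝ B)
    (h : ∀ a, c ≤ ∑ b, q b * M a b) : c ≤ gameValue M := by
  obtain ⟨p, hp, hpv⟩ := exists_row_optimal M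
  calc c ≤ ∑ a, p a * ∑ b, q b * M a b := le_sum_mul_of_mem_stdSimplex hp h
    _ = ∑ b, q b * ∑ a, p a * M a b := sum_sum_swap_mul p q M
    _ ≤ gameValue M := sum_mul_le_of_mem_stdSimplex hq hpv

/-- A column strategy optimal for `M` loses at most `dist M M'` when used in `M'`. The value is thus
1-Lipschitz, which later makes it measurable in the context. -/
lemma gameValue_le_add_dist (M M' : A → B → ℝ) : gameValue M ≤ gameValue M' + dist M M' := by
  obtain ⟨q, hq, hqv⟩ := exists_column_optimal M
  rw [← sub_le_iff_le_add]
  refine le_gameValue hq fun a => ?_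
  have h1 : ∑ b, q b * (M a b - M' a b) ≤ dist M M' :=
    sum_mul_le_of_mem_stdSimplex hq fun b => (le_abs_self _).trans
      ((dist_le_pi_dist (M a) (M' a) b).trans (dist_le_pi_dist M M' a))
  have h2 := hqv a
  simp only [mul_sub, Finset.sum_sub_distrib] at h1
  linarith

lemma continuous_gameValue : Continuous (gameValue : (A → B → ℝ) → ℝ) :=
  (LipschitzWith.of_le_add fun M M' => gameValue_le_add_dist M M').continuous

lemma abs_gameValue_le {M : A → B → ℝ} {c : ℝ} (h : ∀ a b, |M a b| ≤ c) :
    |gameValue M| ≤ c := by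
  rw [abs_le]
  constructor
  · obtain ⟨q, hq, -⟩ := exists_column_optimal M
    exact le_gameValue hq fun a =>
      le_sum_mul_of_mem_stdSimplex hq fun b => (abs_le.1 (h a b)).1
  · obtain ⟨q, hq, hqv⟩ := exists_column_optimal M
    exact (hqv (Classical.arbitrary A)).trans
      (sum_mul_le_of_mem_stdSimplex hq fun b => (abs_le.1 (h _ b)).2)

instance : Nonempty (stdSimplex ℝ A) := by
  classical exact ⟨⟨_, single_mem_stdSimplex ℝ (Classical.arbitrary A)⟩⟩

/-- Open conditions that can be met pointwise can be met by a measurable selection. -/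
lemma exists_measurable_selection {α K : Type*} [MeasurableSpace α] [TopologicalSpace K]
    [TopologicalSpace.SeparableSpace K] [Nonempty K] [MeasurableSpace K] {P : α → K → Prop}
    (hex : ∀ x, ∃ k, P x k) (hopen : ∀ x, IsOpen {k | P x k})
    (hmeas : ∀ k, MeasurableSet {x | P x k}) : ∃ f : α → K, Measurable f ∧ ∀ x, P x (f x) := by
  classical
  have h : ∀ x, ∃ n, P x (TopologicalSpace.denseSeq K n) := fun x => by
    exact (TopologicalSpace.denseRange_denseSeq K).exists_mem_open (hopen x) (hex x)
  -- The first term of a dense sequence that works: its index is measurable in `x`.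
  exact ⟨fun x => TopologicalSpace.denseSeq K (Nat.find (h x)),
    (measurable_from_nat (f := TopologicalSpace.denseSeq K)).comp
      (measurable_find h fun k => hmeas _), fun x => Nat.find_spec (h x)⟩

/-- The slack `η` makes near-optimality an open condition on the mixed action, as the selection from
a dense sequence requires. -/
lemma exists_measurable_row_strategy {η : ℝ} (hη : 0 < η) :
    ∃ P : (A → B → ℝ) → stdSimplex ℝ A, Measurable P ∧
      ∀ M b, ∑ a, (P M : A → ℝ) a * M a b < gameValue M + η := by
  refine exists_measurable_selection (P := fun (M : A → B → ℝ) (p : stdSimplex ℝ A) =>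
    ∀ b, ∑ a, (p : A → ℝ) a * M a b < gameValue M + η) (fun M => ?_) (fun M => ?_) fun p => ?_
  · obtain ⟨p, hp, h⟩ := exists_row_optimal M
    exact ⟨⟨p, hp⟩, fun b => (h b).trans_lt (by linarith)⟩
  · simp only [Set.ofPred_forall]
    refine isOpen_iInter_of_finite fun b => isOpen_lt ?_ continuous_const
    exact continuous_finsetSum _ fun a _ =>
      ((continuous_apply a).comp continuous_subtype_val).mul continuous_const
  · simp only [Set.ofPred_forall]
    refine MeasurableSet.iInter fun b => measurableSet_lt ?_ ?_
    · fun_prop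
    · exact (continuous_gameValue.add continuous_const).measurable

lemma exists_measurable_column_strategy {η : ℝ} (hη : 0 < η) :
    ∃ P : (A → B → ℝ) → stdSimplex ℝ B, Measurable P ∧
      ∀ M a, gameValue M - η < ∑ b, (P M : B → ℝ) b * M a b := by
  refine exists_measurable_selection (P := fun (M : A → B → ℝ) (p : stdSimplex ℝ B) =>
    ∀ a, gameValue M - η < ∑ b, (p : B → ℝ) b * M a b) (fun M => ?_) (fun M => ?_) fun p => ?_
  · obtain ⟨p, hp, h⟩ := exists_column_optimal M
    exact ⟨⟨p, hp⟩, fun b => lt_of_lt_of_le (by linarith) (h b)⟩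
  · simp only [Set.ofPred_forall]
    refine isOpen_iInter_of_finite fun b => isOpen_lt continuous_const ?_
    exact continuous_finsetSum _ fun a _ =>
      ((continuous_apply a).comp continuous_subtype_val).mul continuous_const
  · simp only [Set.ofPred_forall]
    refine MeasurableSet.iInter fun b => measurableSet_lt ?_ ?_
    · exact (continuous_gameValue.sub continuous_const).measurable
    · fun_prop

end FiniteGame

/-! ### Measurable mixed actions as Markov kernels -/

section SimplexKernel

variable {Z A : Type*} [MeasurableSpace Z] [MeasurableSpace A] [Fintype A]

/-- The kernel with weights given by a measurable map to the standard simplex. -/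
noncomputable def simplexKernel (P : Z → stdSimplex ℝ A) (hP : Measurable P) : Kernel Z A where
  toFun z := ∑ a, ENNReal.ofReal ((P z : A → ℝ) a) • Measure.dirac a
  measurable' := by
    refine Measure.measurable_of_measurable_coe _ fun s _ => ?_
    simp only [Measure.coe_finsetSum, Finset.sum_apply, Measure.smul_apply, smul_eq_mul]
    refine Finset.measurable_sum _ fun a _ => Measurable.mul_const ?_ _
    exact ENNReal.measurable_ofReal.comp
      ((measurable_pi_apply a).comp (measurable_subtype_coe.comp hP))

lemma simplexKernel_apply (P : Z → stdSimplex ℝ A) (hP : Measurable P) (z : Z) :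
    simplexKernel P hP z = ∑ a, ENNReal.ofReal ((P z : A → ℝ) a) • Measure.dirac a := rfl

instance (P : Z → stdSimplex ℝ A) (hP : Measurable P) : IsMarkovKernel (simplexKernel P hP) :=
  ⟨fun z => ⟨by
    simp only [simplexKernel_apply, Measure.coe_finsetSum, Finset.sum_apply, Measure.smul_apply,
      measure_univ, smul_eq_mul, mul_one]
    exact (ENNReal.ofReal_sum_of_nonneg fun a _ => (P z).2.1 a).symm.trans
      ((congrArg ENNReal.ofReal (P z).2.2).trans ENNReal.ofReal_one)⟩⟩

lemma simplexKernel_real_singleton [MeasurableSingletonClass A] (P : Z → stdSimplex ℝ A)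
    (hP : Measurable P) (z : Z) (a : A) :
    (simplexKernel P hP z).real {a} = (P z : A → ℝ) a := by
  classical
  simp [Measure.real, simplexKernel_apply, Set.indicator_apply]

lemma real_singleton_mem_stdSimplex [MeasurableSingletonClass A] (μ : Measure A)
    [IsProbabilityMeasure μ] : (fun a => μ.real {a}) ∈ stdSimplex ℝ A :=
  ⟨fun _ => measureReal_nonneg, by
    simp [sum_measureReal_singleton]⟩

end SimplexKernel

/-! ## A one-sided law of large numbers along trajectories -/

section TrajectoryLLN

variable {R : Type*} [MeasurableSpace R]

/-- The tower property: given rounds `0, …, n`, round `n + 1` is drawn from `κ n`. -/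
lemma lintegral_trajMeasure_succ (μ₀ : Measure R) [IsProbabilityMeasure μ₀]
    (κ : (n : ℕ) → Kernel ((_ : Finset.Iic n) → R) R) [∀ n, IsMarkovKernel (κ n)] (n : ℕ)
    {f : ((_ : Finset.Iic n) → R) × R → ENNReal} (hf : Measurable f) :
    ∫⁻ ω, f (Preorder.frestrictLe n ω, ω (n + 1))
        ∂(Kernel.trajMeasure (X := fun _ => R) μ₀ κ) =
      ∫⁻ ω, ∫⁻ r, f (Preorder.frestrictLe n ω, r) ∂(κ n (Preorder.frestrictLe n ω))
        ∂(Kernel.trajMeasure (X := fun _ => R) μ₀ κ) := by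
  have h := Kernel.map_frestrictLe_trajMeasure_compProd_eq_map_trajMeasure
    (X := fun _ => R) (μ₀ := μ₀) (κ := κ) (a := n)
  rw [← lintegral_map (f := f) (g := fun ω : ℕ → R => (Preorder.frestrictLe n ω, ω (n + 1))) hf
    (by fun_prop), ← h, Measure.lintegral_compProd hf, lintegral_map _ (by fun_prop)]
  exact hf.lintegral_kernel_prod_right'

/-- A bounded variable with nonpositive mean has a subgaussian exponential moment. -/
lemma integral_exp_mul_le (μ : Measure R) [IsProbabilityMeasure μ] {Z : R → ℝ}
    (hZ : Measurable Z) {K θ : ℝ} (hθ : 0 ≤ θ) (hK : ∀ r, |Z r| ≤ K) (hθK : θ * K ≤ 1)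
    (hmean : ∫ r, Z r ∂μ ≤ 0) :
    ∫⁻ r, ENNReal.ofReal (Real.exp (θ * Z r)) ∂μ ≤ ENNReal.ofReal (Real.exp ((θ * K) ^ 2)) := by
  have hb : ∀ r, |θ * Z r| ≤ θ * K := fun r => by
    rw [abs_mul, abs_of_nonneg hθ]; exact mul_le_mul_of_nonneg_left (hK r) hθ
  have hint : Integrable Z μ := Integrable.of_bound hZ.aestronglyMeasurable K
    (ae_of_all _ fun r => by simpa using hK r)
  have hexp : Integrable (fun r => Real.exp (θ * Z r)) μ :=
    Integrable.of_bound (by fun_prop) (Real.exp (θ * K)) (ae_of_all _ fun r => by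
      rw [Real.norm_eq_abs, Real.abs_exp]
      exact Real.exp_le_exp.2 ((le_abs_self _).trans (hb r)))
  rw [← ofReal_integral_eq_lintegral_ofReal hexp (ae_of_all _ fun r => (Real.exp_pos _).le)]
  refine ENNReal.ofReal_le_ofReal ?_
  -- The bound exp z ≤ 1 + z + z² for |z| ≤ 1; the linear term has nonpositive mean.
  have hpt : ∀ r, Real.exp (θ * Z r) ≤ (1 + (θ * K) ^ 2) + θ * Z r := fun r => by
    have h1 := (abs_le.1 (Real.abs_exp_sub_one_sub_id_le ((hb r).trans hθK))).2
    have h2 : (θ * Z r) ^ 2 ≤ (θ * K) ^ 2 := by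
      rw [← sq_abs]; exact pow_le_pow_left₀ (abs_nonneg _) (hb r) 2
    linarith
  calc ∫ r, Real.exp (θ * Z r) ∂μ ≤ ∫ r, (1 + (θ * K) ^ 2) + θ * Z r ∂μ :=
        integral_mono hexp ((integrable_const _).add (hint.const_mul θ)) hpt
    _ = (1 + (θ * K) ^ 2) + θ * ∫ r, Z r ∂μ := by
        rw [integral_add (integrable_const _) (hint.const_mul θ), integral_const_mul]; simp
    _ ≤ (θ * K) ^ 2 + 1 := by nlinarith
    _ ≤ Real.exp ((θ * K) ^ 2) := Real.add_one_le_exp _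

/-- The sum depends on rounds `0, …, T` only, so it factors out when round `T + 1` is integrated. -/
lemma exists_measurable_partial_sum (Z : (n : ℕ) → ((_ : Finset.Iic n) → R) × R → ℝ)
    (hZ : ∀ n, Measurable (Z n)) (w : ℕ → ℝ) (T : ℕ) :
    ∃ S : ((_ : Finset.Iic T) → R) → ℝ, Measurable S ∧ ∀ ω : ℕ → R,
      S (Preorder.frestrictLe T ω) =
        ∑ n ∈ Finset.range T, w n * Z n (Preorder.frestrictLe n ω, ω (n + 1)) := by
  induction T with
  | zero => exact ⟨fun _ => 0, measurable_const, fun ω => by simp⟩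
  | succ T ih =>
    obtain ⟨S, hS, hSω⟩ := ih
    refine ⟨fun h => S (Preorder.frestrictLe₂ (π := fun _ => R) T.le_succ h) + w T *
      Z T (Preorder.frestrictLe₂ (π := fun _ => R) T.le_succ h, h ⟨T + 1, by simp⟩), ?_,
      fun ω => ?_⟩
    · have h1 : Measurable (Preorder.frestrictLe₂ (π := fun _ => R) T.le_succ) :=
        Preorder.measurable_frestrictLe₂ _
      exact (hS.comp h1).add (((hZ T).comp (h1.prodMk (measurable_pi_apply _))).const_mul _)
    · rw [Finset.sum_range_succ, ← hSω]
      rfl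

variable (μ₀ : Measure R) [IsProbabilityMeasure μ₀]
  (κ : (n : ℕ) → Kernel ((_ : Finset.Iic n) → R) R) [∀ n, IsMarkovKernel (κ n)]
  {Z : (n : ℕ) → ((_ : Finset.Iic n) → R) × R → ℝ} (hZ : ∀ n, Measurable (Z n)) {K : ℝ}
  (hK : ∀ n p, |Z n p| ≤ K) (hmean : ∀ n h, ∫ r, Z n (h, r) ∂(κ n h) ≤ 0)

include hZ hK hmean

/-- Each round multiplies the exponential moment by at most exp((θK)²), since a weight in [0, 1]
preserves both the bound `K` and the sign of the conditional mean. -/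
lemma lintegral_exp_partial_sum_le {w : ℕ → ℝ} {T : ℕ}
    (hw : ∀ n < T, w n ∈ Set.Icc (0 : ℝ) 1) {θ : ℝ} (hθ : 0 ≤ θ) (hθK : θ * K ≤ 1) :
    ∫⁻ ω, ENNReal.ofReal (Real.exp (θ * ∑ n ∈ Finset.range T,
        w n * Z n (Preorder.frestrictLe n ω, ω (n + 1))))
        ∂(Kernel.trajMeasure (X := fun _ => R) μ₀ κ) ≤
      ENNReal.ofReal (Real.exp ((θ * K) ^ 2 * T)) := by
  induction T with
  | zero => simp
  | succ T ih =>
    obtain ⟨S, hS, hSω⟩ := exists_measurable_partial_sum Z hZ w T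
    have hwT := hw T T.lt_succ_self
    have hf : Measurable (fun p : ((_ : Finset.Iic T) → R) × R =>
        ENNReal.ofReal (Real.exp (θ * S p.1)) *
          ENNReal.ofReal (Real.exp (θ * (w T * Z T p)))) := by
      have := hZ T
      fun_prop
    have key := lintegral_trajMeasure_succ μ₀ κ T hf
    have hK0 : 0 ≤ K := (abs_nonneg _).trans (hK 0 (Nonempty.some (by
      have := nonempty_of_isProbabilityMeasure μ₀
      infer_instance)))
    calc _ = ∫⁻ ω, ENNReal.ofReal (Real.exp (θ * S (Preorder.frestrictLe T ω))) *
          ENNReal.ofReal (Real.exp (θ * (w T * Z T (Preorder.frestrictLe T ω, ω (T + 1)))))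
          ∂(Kernel.trajMeasure (X := fun _ => R) μ₀ κ) := by
          refine lintegral_congr fun ω => ?_
          rw [Finset.sum_range_succ, ← hSω, mul_add, Real.exp_add,
            ENNReal.ofReal_mul (Real.exp_pos _).le]
      _ = _ := key
      _ ≤ ∫⁻ ω, ENNReal.ofReal (Real.exp (θ * S (Preorder.frestrictLe T ω))) *
          ENNReal.ofReal (Real.exp ((θ * K) ^ 2))
          ∂(Kernel.trajMeasure (X := fun _ => R) μ₀ κ) := by
          refine lintegral_mono fun ω => ?_
          have hm := hZ T
          simp only
          rw [lintegral_const_mul _ (by fun_prop)]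
          refine mul_le_mul_right ?_ _
          refine integral_exp_mul_le _ (by fun_prop) hθ (fun r => ?_) hθK ?_
          · rw [abs_mul, abs_of_nonneg hwT.1]
            calc _ ≤ 1 * K := mul_le_mul hwT.2 (hK _ _) (abs_nonneg _) zero_le_one
              _ = K := one_mul K
          · rw [integral_const_mul]
            exact mul_nonpos_of_nonneg_of_nonpos hwT.1 (hmean _ _)
      _ ≤ ENNReal.ofReal (Real.exp ((θ * K) ^ 2 * T)) *
          ENNReal.ofReal (Real.exp ((θ * K) ^ 2)) := by
          rw [lintegral_mul_const' _ _ ENNReal.ofReal_ne_top]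
          refine mul_le_mul_left ?_ _
          simp only [hSω]
          exact ih fun n hn => hw n (hn.trans T.lt_succ_self)
      _ = _ := by
          rw [← ENNReal.ofReal_mul (Real.exp_pos _).le, ← Real.exp_add]
          push_cast
          ring_nf

/-- Weighted partial sums of bounded increments with nonpositive conditional means are
asymptotically at most of order `o(T)`, almost surely. -/
theorem ae_forall_eventually_partial_sum_le {w : ℕ → ℕ → ℝ}
    (hw : ∀ T, ∀ n < T, w T n ∈ Set.Icc (0 : ℝ) 1) :
    ∀ᵐ ω ∂(Kernel.trajMeasure (X := fun _ => R) μ₀ κ), ∀ ε > 0, ∀ᶠ T : ℕ in atTop,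
      ∑ n ∈ Finset.range T, w T n * Z n (Preorder.frestrictLe n ω, ω (n + 1)) ≤ ε * T := by
  suffices h : ∀ ε : ℝ, 0 < ε → ∀ᵐ ω ∂(Kernel.trajMeasure (X := fun _ => R) μ₀ κ),
      ∀ᶠ T : ℕ in atTop,
        ∑ n ∈ Finset.range T, w T n * Z n (Preorder.frestrictLe n ω, ω (n + 1)) ≤ ε * T by
    have h' := ae_all_iff.2 fun m : ℕ => h (1 / ((m : ℝ) + 1)) (by positivity)
    filter_upwards [h'] with ω hω ε hε
    obtain ⟨m, hm⟩ := exists_nat_one_div_lt hε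
    filter_upwards [hω m] with T hT
    exact hT.trans (mul_le_mul_of_nonneg_right hm.le (Nat.cast_nonneg T))
  intro ε hε
  set μ := Kernel.trajMeasure (X := fun _ => R) μ₀ κ
  obtain ⟨L, hL1, hLK⟩ : ∃ L : ℝ, 1 ≤ L ∧ K ≤ L := ⟨max 1 K, le_max_left _ _, le_max_right _ _⟩
  have hL : ∀ n p, |Z n p| ≤ L := fun n p => (hK n p).trans hLK
  -- The first constraint allows the exponential bound; the second makes the Chernoff exponent
  -- (θL)²T - θεT at most -θεT/2.
  obtain ⟨θ, hθ, hθL, hθε⟩ : ∃ θ : ℝ, 0 < θ ∧ θ * L ≤ 1 ∧ θ * L ^ 2 ≤ ε / 2 := by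
    refine ⟨min (1 / L) (ε / (2 * L ^ 2)), by positivity, ?_, ?_⟩
    · calc _ ≤ 1 / L * L := mul_le_mul_of_nonneg_right (min_le_left _ _) (by linarith)
        _ = 1 := by field_simp
    · calc _ ≤ ε / (2 * L ^ 2) * L ^ 2 :=
            mul_le_mul_of_nonneg_right (min_le_right _ _) (by positivity)
        _ = ε / 2 := by field_simp
  have hmarkov : ∀ T : ℕ, μ {ω | ε * T < ∑ n ∈ Finset.range T,
      w T n * Z n (Preorder.frestrictLe n ω, ω (n + 1))} ≤
        ENNReal.ofReal (Real.exp (-(θ * ε / 2)) ^ T) := fun T => by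
    have h1 := lintegral_exp_partial_sum_le μ₀ κ hZ hL hmean (hw T) hθ.le hθL
    obtain ⟨S, hS, hSω⟩ := exists_measurable_partial_sum Z hZ (w T) T
    simp only [← hSω] at h1 ⊢
    have h2 := (mul_meas_ge_le_lintegral (μ := μ) (f := fun ω => ENNReal.ofReal
      (Real.exp (θ * S (Preorder.frestrictLe T ω)))) (by fun_prop)
      (ENNReal.ofReal (Real.exp (θ * (ε * T))))).trans h1
    have h3 : μ {ω | ε * T < S (Preorder.frestrictLe T ω)} ≤
        μ {ω | ENNReal.ofReal (Real.exp (θ * (ε * T))) ≤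
          ENNReal.ofReal (Real.exp (θ * S (Preorder.frestrictLe T ω)))} := by
      refine measure_mono fun ω hω => ENNReal.ofReal_le_ofReal (Real.exp_le_exp.2 ?_)
      exact mul_le_mul_of_nonneg_left (le_of_lt hω) hθ.le
    have hpos : 0 < Real.exp (θ * (ε * T)) := Real.exp_pos _
    refine h3.trans ?_
    rw [mul_comm, ← ENNReal.le_div_iff_mul_le (Or.inl (by simpa using hpos))
      (Or.inl ENNReal.ofReal_ne_top), ← ENNReal.ofReal_div_of_pos hpos, ← Real.exp_sub] at h2
    refine h2.trans (ENNReal.ofReal_le_ofReal ?_)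
    rw [← Real.exp_nat_mul]
    refine Real.exp_le_exp.2 ?_
    have : (θ * L) ^ 2 * T ≤ θ * (ε / 2) * T := by
      refine mul_le_mul_of_nonneg_right ?_ (Nat.cast_nonneg T)
      calc (θ * L) ^ 2 = θ * (θ * L ^ 2) := by ring
        _ ≤ _ := mul_le_mul_of_nonneg_left hθε hθ.le
    nlinarith
  -- Geometric tails are summable, so Borel-Cantelli applies. Each `T` is estimated separately,
  -- hence the weights may depend on `T`.
  have hsum : ∑' T : ℕ, μ {ω | ε * T < ∑ n ∈ Finset.range T,
      w T n * Z n (Preorder.frestrictLe n ω, ω (n + 1))} ≠ ⊤ := by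
    refine ne_top_of_le_ne_top ?_ (ENNReal.tsum_le_tsum hmarkov)
    have hlt : Real.exp (-(θ * ε / 2)) < 1 := by
      rw [Real.exp_lt_one_iff]; linarith [mul_pos hθ hε]
    exact (summable_geometric_of_lt_one (Real.exp_pos _).le hlt).tsum_ofReal_ne_top
  filter_upwards [ae_eventually_notMem hsum] with ω hω
  filter_upwards [hω] with T hT
  simpa using hT

end TrajectoryLLN

/-! ## Metric projection onto closed convex sets -/

section Projection

variable {E : Type*} [NormedAddCommGroup E] [InnerProductSpace ℝ E] [CompleteSpace E]

/-- Everything follows from the variational inequality for nearest points; adding it at two points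
shows that the projection is 1-Lipschitz. Continuity makes the Player's strategy measurable. -/
lemma exists_continuous_projection {C : Set E} (hne : C.Nonempty) (hcl : IsClosed C)
    (hconv : Convex ℝ C) :
    ∃ pr : E → E, Continuous pr ∧ (∀ y, pr y ∈ C) ∧
      (∀ y, ‖y - pr y‖ = Metric.infDist y C) ∧
      ∀ y, ∀ c ∈ C, inner ℝ (y - pr y) c ≤ inner ℝ (y - pr y) (pr y) := by
  choose pr hmem hpr using exists_norm_eq_iInf_of_complete_convex hne hcl.isComplete hconv
  have hvar : ∀ y, ∀ c ∈ C, inner ℝ (y - pr y) (c - pr y) ≤ 0 := fun y =>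
    (norm_eq_iInf_iff_real_inner_le_zero hconv (hmem y)).1 (hpr y)
  refine ⟨pr, ?_, hmem, fun y => ?_, fun y c hc => ?_⟩
  · refine (LipschitzWith.mk_one fun y z => ?_).continuous
    rw [dist_eq_norm, dist_eq_norm]
    have h1 := hvar y _ (hmem z)
    have h2 := hvar z _ (hmem y)
    have h3 : inner ℝ (pr y - pr z) (pr y - pr z) ≤ inner ℝ (y - z) (pr y - pr z) := by
      simp only [inner_sub_left, inner_sub_right] at h1 h2 ⊢
      linarith
    rw [real_inner_self_eq_norm_mul_norm] at h3
    have h4 := h3.trans (real_inner_le_norm _ _)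
    rcases (norm_nonneg (pr y - pr z)).eq_or_lt with h | h
    · rw [← h]; exact norm_nonneg _
    · exact le_of_mul_le_mul_right h4 h
  · simp only [hpr y, Metric.infDist_eq_iInf, dist_eq_norm]
  · have := hvar y c hc
    rw [inner_sub_right] at this
    linarith

end Projection

/-- Mixed extensions of bounded measurable families of matrices are integrable. -/
lemma integrable_sum_kernel_mul {Z A B : Type*} [MeasurableSpace Z] [MeasurableSpace A]
    [MeasurableSpace B] [Fintype A] [MeasurableSingletonClass A] [Fintype B]
    [MeasurableSingletonClass B] (μ : Measure Z) [IsFiniteMeasure μ] (κ : Kernel Z A)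
    [IsMarkovKernel κ] (η : Kernel Z B) [IsMarkovKernel η] {F : Z → A → B → ℝ}
    (hF : ∀ a b, Measurable (fun z => F z a b)) {L : ℝ} (hL : ∀ z a b, |F z a b| ≤ L) :
    Integrable (fun z => ∑ a, (κ z).real {a} * ∑ b, (η z).real {b} * F z a b) μ := by
  refine Integrable.of_bound (C := L) ?_ (ae_of_all _ fun z => ?_)
  · exact Measurable.aestronglyMeasurable (Finset.measurable_sum _ fun a _ =>
      (Kernel.measurable_coe _ (measurableSet_singleton a)).ennreal_toReal.mul
        (Finset.measurable_sum _ fun b _ =>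
          (Kernel.measurable_coe _ (measurableSet_singleton b)).ennreal_toReal.mul (hF a b)))
  · have h1 := real_singleton_mem_stdSimplex (κ z)
    have h2 := real_singleton_mem_stdSimplex (η z)
    rw [Real.norm_eq_abs, abs_le]
    exact ⟨le_sum_mul_of_mem_stdSimplex h1 fun a => le_sum_mul_of_mem_stdSimplex h2 fun b =>
        (abs_le.1 (hL z a b)).1,
      sum_mul_le_of_mem_stdSimplex h1 fun a => sum_mul_le_of_mem_stdSimplex h2 fun b =>
        (abs_le.1 (hL z a b)).2⟩

/-! ## Expected payoffs when Nature monitors the non-sensitive context only -/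

namespace ContextGame

variable {X S A B ι : Type*} [MeasurableSpace X] [MeasurableSpace S]
  [MeasurableSpace A] [MeasurableSpace B]
  [Fintype S] [Nonempty S] [MeasurableSingletonClass S]

lemma integral_law_eq (g : ContextGame X S A B X ι) {f : X × S → ℝ} (hf : Integrable f g.law) :
    ∫ p, f p ∂g.law = ∫ x, ∑ s, (g.law.condKernel x).real {s} * f (x, s) ∂g.law.fst := by
  conv_lhs => rw [← g.law.disintegrate g.law.condKernel]
  rw [Measure.integral_compProd (by rwa [g.law.disintegrate g.law.condKernel])]
  refine integral_congr_ae (ae_of_all _ fun x => ?_)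
  simp only
  rw [integral_fintype (Integrable.of_finite)]
  simp

variable [Fintype ι]

/-- The expected payoff in the direction `u` of a pair of actions, given the non-sensitive
context. -/
noncomputable def meanPayoff (g : ContextGame X S A B X ι) (u : EuclideanSpace ℝ ι) (x : X) :
    A → B → ℝ :=
  fun a b => ∑ s, (g.law.condKernel x).real {s} * inner ℝ u (g.payoff ((x, s), (a, b)))

lemma measurable_meanPayoff (g : ContextGame X S A B X ι) :
    Measurable (fun p : EuclideanSpace ℝ ι × X => g.meanPayoff p.1 p.2) := by
  refine measurable_pi_lambda _ fun a => measurable_pi_lambda _ fun b => ?_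
  refine Finset.measurable_sum _ fun s _ => Measurable.mul ?_ ?_
  · exact ((Kernel.measurable_coe _ (measurableSet_singleton s)).comp measurable_snd).ennreal_toReal
  · exact measurable_fst.inner (g.measurable_payoff.comp (by fun_prop))

lemma abs_meanPayoff_le (g : ContextGame X S A B X ι) {K : ℝ} (hK : ∀ r, ‖g.payoff r‖ ≤ K)
    (u : EuclideanSpace ℝ ι) (x : X) (a : A) (b : B) : |g.meanPayoff u x a b| ≤ ‖u‖ * K := by
  have hsimp := real_singleton_mem_stdSimplex (g.law.condKernel x)
  have h : ∀ s, |inner ℝ u (g.payoff ((x, s), (a, b)))| ≤ ‖u‖ * K := fun s =>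
    (abs_real_inner_le_norm _ _).trans (mul_le_mul_of_nonneg_left (hK _) (norm_nonneg _))
  rw [abs_le]
  exact ⟨le_sum_mul_of_mem_stdSimplex hsimp fun s => (abs_le.1 (h s)).1,
    sum_mul_le_of_mem_stdSimplex hsimp fun s => (abs_le.1 (h s)).2⟩

variable [Fintype A] [Fintype B]

section Value

variable [Nonempty A] [Nonempty B]

/-- The expected value of the one-shot game in the direction `u`. -/
noncomputable def expectedValue (g : ContextGame X S A B X ι) (u : EuclideanSpace ℝ ι) : ℝ :=
  ∫ x, gameValue (g.meanPayoff u x) ∂g.law.fst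

lemma measurable_gameValue_meanPayoff (g : ContextGame X S A B X ι) (u : EuclideanSpace ℝ ι) :
    Measurable (fun x => gameValue (g.meanPayoff u x)) := by
  have h : Measurable (fun x => g.meanPayoff u x) :=
    g.measurable_meanPayoff.comp (g := fun p : EuclideanSpace ℝ ι × X => g.meanPayoff p.1 p.2)
      (f := fun x : X => (u, x)) measurable_prodMk_left
  have h2 : Measurable (gameValue : (A → B → ℝ) → ℝ) := continuous_gameValue.measurable
  exact h2.comp h

lemma integrable_gameValue_meanPayoff (g : ContextGame X S A B X ι) {K : ℝ}
    (hK : ∀ r, ‖g.payoff r‖ ≤ K) (u : EuclideanSpace ℝ ι) :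
    Integrable (fun x => gameValue (g.meanPayoff u x)) g.law.fst :=
  Integrable.of_bound (g.measurable_gameValue_meanPayoff u).aestronglyMeasurable (‖u‖ * K)
    (ae_of_all _ fun x => by
      rw [Real.norm_eq_abs]; exact abs_gameValue_le fun a b => g.abs_meanPayoff_le hK u x a b)

end Value

variable [MeasurableSingletonClass A] [MeasurableSingletonClass B]

/-- Neither action depends on the current `s`, so disintegrating the law along `x` averages `s` out
and leaves the mixed extension of `meanPayoff` at each `x`. -/
lemma integral_roundSucc (g : ContextGame X S A B X ι) (hmon : g.monitor = Prod.fst) {K : ℝ}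
    (hK : ∀ r, ‖g.payoff r‖ ≤ K) (σ : PlayerStrategy X S A ι) (ν : NatureStrategy X S A B X)
    (n : ℕ) (h : (_ : Finset.Iic n) → Round X S A B) (u : EuclideanSpace ℝ ι) :
    ∫ r, inner ℝ u (g.payoff r) ∂(g.roundSucc σ ν n h) =
      ∫ x, ∑ a, (σ.next n (g.obsHist n h, x)).real {a} *
        ∑ b, (ν.next n (h, x)).real {b} * g.meanPayoff u x a b ∂g.law.fst := by
  have hm : Measurable (fun r => (inner ℝ u (g.payoff r) : ℝ)) :=
    measurable_const.inner g.measurable_payoff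
  have hb : ∀ r, ‖(inner ℝ u (g.payoff r) : ℝ)‖ ≤ ‖u‖ * K := fun r =>
    (norm_inner_le_norm _ _).trans (mul_le_mul_of_nonneg_left (hK _) (norm_nonneg _))
  rw [roundSucc, ProbabilityTheory.integral_compProd
    (Integrable.of_bound hm.aestronglyMeasurable _ (ae_of_all _ hb))]
  have hinner : ∀ p : X × S, ∫ c : A × B, inner ℝ u (g.payoff (p, c)) ∂(((σ.next n).comap
        (fun p : ((_ : Finset.Iic n) → Round X S A B) × (X × S) => (g.obsHist n p.1, p.2.1))
        (((g.measurable_obsHist n).comp measurable_fst).prodMk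
          (measurable_fst.comp measurable_snd))) ×ₖ
      ((ν.next n).comap
        (fun p : ((_ : Finset.Iic n) → Round X S A B) × (X × S) => (p.1, g.monitor p.2))
        (measurable_fst.prodMk (g.measurable_monitor.comp measurable_snd)))) (h, p) =
      ∑ a, (σ.next n (g.obsHist n h, p.1)).real {a} *
        ∑ b, (ν.next n (h, p.1)).real {b} * inner ℝ u (g.payoff (p, (a, b))) := fun p => by
    rw [Kernel.prod_apply, Kernel.comap_apply, Kernel.comap_apply,
      integral_fintype Integrable.of_finite, Fintype.sum_prod_type]
    refine Finset.sum_congr rfl fun a _ => ?_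
    rw [Finset.mul_sum]
    refine Finset.sum_congr rfl fun b _ => ?_
    rw [← Set.singleton_prod_singleton, measureReal_prod_prod, hmon, smul_eq_mul, mul_assoc]
  simp only [hinner, Kernel.const_apply]
  rw [g.integral_law_eq]
  · refine integral_congr_ae (ae_of_all _ fun x => ?_)
    simp only [meanPayoff, Finset.mul_sum]
    rw [Finset.sum_comm]
    refine Finset.sum_congr rfl fun a _ => ?_
    rw [Finset.sum_comm]
    refine Finset.sum_congr rfl fun b _ => Finset.sum_congr rfl fun s _ => by ring
  · exact integrable_sum_kernel_mul g.law
      ((σ.next n).comap (fun p : X × S => (g.obsHist n h, p.1))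
        (measurable_const.prodMk measurable_fst))
      ((ν.next n).comap (fun p : X × S => (h, p.1)) (measurable_const.prodMk measurable_fst))
      (F := fun p a b => inner ℝ u (g.payoff (p, (a, b))))
      (fun a b => hm.comp (measurable_id.prodMk measurable_const)) fun p a b => hb (p, (a, b))

lemma integrable_sum_strategies (g : ContextGame X S A B X ι) {K : ℝ}
    (hK : ∀ r, ‖g.payoff r‖ ≤ K) (σ : PlayerStrategy X S A ι) (ν : NatureStrategy X S A B X)
    (n : ℕ) (h : (_ : Finset.Iic n) → Round X S A B) (u : EuclideanSpace ℝ ι) :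
    Integrable (fun x => ∑ a, (σ.next n (g.obsHist n h, x)).real {a} *
      ∑ b, (ν.next n (h, x)).real {b} * g.meanPayoff u x a b) g.law.fst :=
  integrable_sum_kernel_mul g.law.fst
    ((σ.next n).comap (fun x : X => (g.obsHist n h, x)) measurable_prodMk_left)
    ((ν.next n).comap (fun x : X => (h, x)) measurable_prodMk_left)
    (fun a b => (measurable_pi_apply b).comp ((measurable_pi_apply a).comp
      (g.measurable_meanPayoff.comp (g := fun p : EuclideanSpace ℝ ι × X => g.meanPayoff p.1 p.2)
        (f := fun x : X => (u, x)) measurable_prodMk_left)))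
    fun x a b => g.abs_meanPayoff_le hK u x a b

end ContextGame

/-! ## Blackwell's condition is sufficient -/

/-- Blackwell's one-step estimate: bound the new distance by the distance to the old projection and
expand the square. Because 0 ∈ C, the old distance is at most `K`, whence ‖m - pr y‖ ≤ 3K and the
constant 9K². -/
lemma mul_infDist_sq_le {E : Type*} [NormedAddCommGroup E] [InnerProductSpace ℝ E] {C : Set E}
    {pr : E → E} (hmem : ∀ y, pr y ∈ C) (hdist : ∀ y, ‖y - pr y‖ = Metric.infDist y C)
    (h0 : (0 : E) ∈ C) {K T : ℝ} (hT : 0 ≤ T) {y y' m : E} (hy : ‖y‖ ≤ K) (hm : ‖m‖ ≤ K)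
    (hy' : (T + 1) • y' = T • y + m) :
    ((T + 1) * Metric.infDist y' C) ^ 2 ≤
      (T * Metric.infDist y C) ^ 2 + 2 * (T * inner ℝ (y - pr y) (m - pr y)) + 9 * K ^ 2 := by
  have hd : ‖y - pr y‖ ≤ K := by
    rw [hdist]
    exact (Metric.infDist_le_dist_of_mem h0).trans (by simpa using hy)
  have h1 : ‖m - pr y‖ ≤ 3 * K := by
    calc ‖m - pr y‖ = ‖m - y + (y - pr y)‖ := by congr 1; abel
      _ ≤ ‖m - y‖ + ‖y - pr y‖ := norm_add_le _ _
      _ ≤ ‖m‖ + ‖y‖ + ‖y - pr y‖ := by gcongr; exact norm_sub_le _ _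
      _ ≤ 3 * K := by linarith
  have h2 : (T + 1) * Metric.infDist y' C ≤ ‖T • (y - pr y) + (m - pr y)‖ := by
    calc (T + 1) * Metric.infDist y' C ≤ (T + 1) * ‖y' - pr y‖ := by
          rw [← dist_eq_norm]
          exact mul_le_mul_of_nonneg_left (Metric.infDist_le_dist_of_mem (hmem y)) (by linarith)
      _ = ‖(T + 1) • (y' - pr y)‖ := by
          rw [norm_smul, Real.norm_of_nonneg (by linarith)]
      _ = _ := by
          rw [smul_sub, hy', smul_sub, add_smul, one_smul]; congr 1; abel
  have h3 : 0 ≤ (T + 1) * Metric.infDist y' C :=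
    mul_nonneg (by linarith) Metric.infDist_nonneg
  calc _ ≤ ‖T • (y - pr y) + (m - pr y)‖ ^ 2 := pow_le_pow_left₀ h3 h2 2
    _ = (T * Metric.infDist y C) ^ 2 + 2 * (T * inner ℝ (y - pr y) (m - pr y)) +
          ‖m - pr y‖ ^ 2 := by
        rw [norm_add_sq_real, norm_smul, hdist, inner_smul_left, Real.norm_of_nonneg hT]; simp
    _ ≤ _ := by
        have := pow_le_pow_left₀ (norm_nonneg _) h1 2
        nlinarith

lemma tendsto_infDist_of_recursion {d Z : ℕ → ℝ} {K : ℝ} (hd : ∀ n, 0 ≤ d n)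
    (hd1 : d 1 ≤ K)
    (hstep : ∀ n : ℕ, (((n : ℝ) + 1 + 1) * d (n + 2)) ^ 2 ≤ (((n : ℝ) + 1) * d (n + 1)) ^ 2 +
      2 * (((n : ℝ) + 1) * (Z n + 1 / ((n : ℝ) + 1))) + 9 * K ^ 2)
    (hZ : ∀ ε > 0, ∀ᶠ T : ℕ in atTop,
      ∑ n ∈ Finset.range T, (((n : ℝ) + 1) / T) * Z n ≤ ε * T) :
    Tendsto d atTop (𝓝 0) := by
  -- Summing the recursion: the tolerance 1/(n+1), multiplied by 2(n+1), costs 2 per round.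
  have hrec : ∀ T : ℕ, (((T : ℝ) + 1) * d (T + 1)) ^ 2 ≤
      2 * ∑ n ∈ Finset.range T, ((n : ℝ) + 1) * Z n + (9 * K ^ 2 + 2) * (T + 1) := fun T => by
    induction T with
    | zero =>
      have := pow_le_pow_left₀ (hd 1) hd1 2
      simp only [CharP.cast_eq_zero, zero_add, one_mul, Finset.range_zero, Finset.sum_empty]
      nlinarith [sq_nonneg K]
    | succ T ih =>
      have h1 := hstep T
      rw [mul_add, mul_one_div_cancel (by positivity)] at h1
      rw [Finset.sum_range_succ]
      push_cast
      nlinarith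
  rw [← tendsto_add_atTop_iff_nat 1]
  have hsq : Tendsto (fun T : ℕ => d (T + 1) ^ 2) atTop (𝓝 0) := by
    rw [Metric.tendsto_atTop']
    intro ε hε
    have hlim : Tendsto (fun T : ℕ => (9 * K ^ 2 + 2) * (1 / ((T : ℝ) + 1))) atTop (𝓝 0) := by
      have := tendsto_one_div_add_atTop_nhds_zero_nat.const_mul (9 * K ^ 2 + 2)
      rwa [mul_zero] at this
    obtain ⟨T₀, hT₀⟩ := eventually_atTop.1 ((hZ (ε / 4) (by positivity)).and
      (hlim.eventually (gt_mem_nhds (show (0 : ℝ) < ε / 2 by positivity))))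
    refine ⟨T₀, fun T hT => ?_⟩
    obtain ⟨h1, h2⟩ := hT₀ T hT.le
    have hTpos : (0 : ℝ) < T := by exact_mod_cast (Nat.zero_le _).trans_lt hT
    -- Normalising by `T` puts the weights in [0, 1], as the law of large numbers requires; the
    -- factor `T` restored here gives order T², matching the left-hand side of the recursion.
    have h3 : ∑ n ∈ Finset.range T, ((n : ℝ) + 1) * Z n ≤ ε / 4 * T ^ 2 := by
      have : ∑ n ∈ Finset.range T, ((n : ℝ) + 1) * Z n =
          T * ∑ n ∈ Finset.range T, (((n : ℝ) + 1) / T) * Z n := by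
        rw [Finset.mul_sum]
        exact Finset.sum_congr rfl fun n _ => by field_simp
      rw [this]
      nlinarith
    rw [dist_zero_right, Real.norm_of_nonneg (sq_nonneg _)]
    have h4 := hrec T
    rw [mul_one_div, div_lt_iff₀ (by positivity)] at h2
    rw [mul_pow] at h4
    have h5 : ((T : ℝ) + 1) ^ 2 * d (T + 1) ^ 2 < ((T : ℝ) + 1) ^ 2 * ε := by
      nlinarith
    exact lt_of_mul_lt_mul_left h5 (by positivity)
  have := hsq.sqrt
  simpa [Real.sqrt_sq (hd _)] using this

namespace ContextGame

variable {X S A B ι : Type*} [MeasurableSpace X] [MeasurableSpace S]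
  [MeasurableSpace A] [MeasurableSpace B]

/-- The average payoff in terms of the observations of the Player. -/
noncomputable def obsAvg (X S : Type*) {ι : Type*} (n : ℕ)
    (o : (_ : Finset.Iic n) → Obs X S ι) : EuclideanSpace ℝ ι :=
  ((n : ℝ) + 1)⁻¹ • ∑ i, (o i).1

lemma measurable_obsAvg [Fintype ι] (n : ℕ) : Measurable (obsAvg X S (ι := ι) n) := by
  have h : Measurable (fun o : (_ : Finset.Iic n) → Obs X S ι => ∑ i, (o i).1) :=
    Finset.measurable_sum _ fun i _ => measurable_fst.comp (measurable_pi_apply i)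
  exact h.const_smul ((n : ℝ) + 1)⁻¹

lemma obsAvg_obsHist {Y : Type*} [MeasurableSpace Y] (g : ContextGame X S A B Y ι) (n : ℕ)
    (ω : ℕ → Round X S A B) :
    obsAvg X S n (g.obsHist n (Preorder.frestrictLe n ω)) = g.avgPayoff (n + 1) ω := by
  simp only [obsAvg, avgPayoff, obsHist, Preorder.frestrictLe_apply]
  rw [Finset.sum_coe_sort (Finset.Iic n) (fun i => g.payoff (ω i)), Nat.range_succ_eq_Iic]
  push_cast
  rfl

lemma norm_avgPayoff_le [Fintype ι] {Y : Type*} [MeasurableSpace Y] (g : ContextGame X S A B Y ι) {K : ℝ}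
    (hK : ∀ r, ‖g.payoff r‖ ≤ K) (T : ℕ) (ω : ℕ → Round X S A B) :
    ‖g.avgPayoff (T + 1) ω‖ ≤ K := by
  rw [avgPayoff, norm_smul, norm_inv, Real.norm_of_nonneg (Nat.cast_nonneg _),
    inv_mul_le_iff₀ (by positivity)]
  calc _ ≤ ∑ t ∈ Finset.range (T + 1), K := norm_sum_le_of_le _ fun t _ => hK _
    _ = _ := by simp

lemma avgPayoff_succ (g : ContextGame X S A B X ι) (n : ℕ) (ω : ℕ → Round X S A B) :
    (((n : ℝ) + 1) + 1) • g.avgPayoff (n + 2) ω =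
      ((n : ℝ) + 1) • g.avgPayoff (n + 1) ω + g.payoff (ω (n + 1)) := by
  have h1 : (n : ℝ) + 1 + 1 ≠ 0 := by positivity
  have h2 : (n : ℝ) + 1 ≠ 0 := by positivity
  simp only [avgPayoff]
  rw [Finset.sum_range_succ _ (n + 1)]
  push_cast
  rw [show (n : ℝ) + 2 = n + 1 + 1 by ring, smul_smul, smul_smul, mul_inv_cancel₀ h1,
    mul_inv_cancel₀ h2, one_smul, one_smul]

variable [Fintype S] [Nonempty S] [MeasurableSingletonClass S]
  [Fintype A] [Nonempty A] [MeasurableSingletonClass A]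
  [Fintype B] [Nonempty B] [MeasurableSingletonClass B] [Fintype ι]

/-- Blackwell's theorem: a closed convex set is approachable as soon as every half-space that
contains it is. -/
theorem approachable_of_expectedValue_le (g : ContextGame X S A B X ι)
    (hmon : g.monitor = Prod.fst) {K : ℝ} (hK : ∀ r, ‖g.payoff r‖ ≤ K)
    {C : Set (EuclideanSpace ℝ ι)} (h0 : 0 ∈ C) (hcl : IsClosed C) (hconv : Convex ℝ C)
    (hC : ∀ u r, (∀ c ∈ C, inner ℝ u c ≤ r) → g.expectedValue u ≤ r) :
    g.Approachable C := by
  obtain ⟨pr, hprc, hmem, hdist, hsupp⟩ := exists_continuous_projection ⟨0, h0⟩ hcl hconv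
  have hη : ∀ n : ℕ, (0 : ℝ) < 1 / ((n : ℝ) + 1) := fun n => by positivity
  choose P hPm hP using fun n => exists_measurable_row_strategy (A := A) (B := B) (hη n)
  let gap : (n : ℕ) → ((_ : Finset.Iic n) → Obs X S ι) → EuclideanSpace ℝ ι :=
    fun n o => obsAvg X S n o - pr (obsAvg X S n o)
  have hgap : ∀ n, Measurable (gap n) := fun n =>
    (measurable_obsAvg n).sub (hprc.measurable.comp (measurable_obsAvg n))
  have hstrat : ∀ n, Measurable (fun z : ((_ : Finset.Iic n) → Obs X S ι) × X =>
      P n (g.meanPayoff (gap n z.1) z.2)) := fun n =>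
    (hPm n).comp (g.measurable_meanPayoff.comp
      (g := fun p : EuclideanSpace ℝ ι × X => g.meanPayoff p.1 p.2)
      (f := fun z : ((_ : Finset.Iic n) → Obs X S ι) × X => (gap n z.1, z.2))
      (((hgap n).comp measurable_fst).prodMk measurable_snd))
  let σ : PlayerStrategy X S A ι :=
    -- The first round does not affect the limit, so any action will do.
    { first := Kernel.const X (Measure.dirac (Classical.arbitrary A))
      next := fun n => simplexKernel _ (hstrat n)
      isMarkov_first := inferInstance
      isMarkov_next := fun n => inferInstance }
  refine ⟨σ, fun ν => ?_⟩
  -- Subtracting the tolerance of the near-optimal strategy makes the conditional mean nonpositive.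
  let Z : (n : ℕ) → ((_ : Finset.Iic n) → Round X S A B) × Round X S A B → ℝ := fun n p =>
    inner ℝ (gap n (g.obsHist n p.1))
      (g.payoff p.2 - pr (obsAvg X S n (g.obsHist n p.1))) - 1 / ((n : ℝ) + 1)
  have hZm : ∀ n, Measurable (Z n) := fun n => by
    have h1 : Measurable (fun p : ((_ : Finset.Iic n) → Round X S A B) × Round X S A B =>
      g.obsHist n p.1) := (g.measurable_obsHist n).comp measurable_fst
    exact (((hgap n).comp h1).inner ((g.measurable_payoff.comp measurable_snd).sub
      (hprc.measurable.comp ((measurable_obsAvg n).comp h1)))).sub_const _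
  have hobs : ∀ n h, ‖obsAvg X S n (g.obsHist n h)‖ ≤ K := fun n h => by
    rw [obsAvg, norm_smul, norm_inv, Real.norm_of_nonneg (by positivity),
      inv_mul_le_iff₀ (by positivity)]
    calc _ ≤ ∑ i : Finset.Iic n, K := norm_sum_le_of_le _ fun t _ => hK _
      _ = _ := by simp
  have hgapK : ∀ n h, ‖gap n (g.obsHist n h)‖ ≤ K := fun n h => by
    simp only [gap, hdist]
    exact (Metric.infDist_le_dist_of_mem h0).trans (by simpa using hobs n h)
  have hK0 : ∀ n, ((_ : Finset.Iic n) → Round X S A B) → 0 ≤ K := fun n h =>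
    (norm_nonneg _).trans (hgapK n h)
  have hZK : ∀ n p, |Z n p| ≤ K * (3 * K) + 1 := fun n p => by
    have h1 : ‖g.payoff p.2 - pr (obsAvg X S n (g.obsHist n p.1))‖ ≤ 3 * K := by
      calc _ = ‖(g.payoff p.2 - obsAvg X S n (g.obsHist n p.1)) + gap n (g.obsHist n p.1)‖ := by
            congr 1; simp only [gap]; abel
        _ ≤ ‖g.payoff p.2 - obsAvg X S n (g.obsHist n p.1)‖ + ‖gap n (g.obsHist n p.1)‖ :=
            norm_add_le _ _
        _ ≤ ‖g.payoff p.2‖ + ‖obsAvg X S n (g.obsHist n p.1)‖ + ‖gap n (g.obsHist n p.1)‖ := by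
            gcongr; exact norm_sub_le _ _
        _ ≤ 3 * K := by linarith [hK p.2, hobs n p.1, hgapK n p.1]
    have h2 := (abs_real_inner_le_norm (gap n (g.obsHist n p.1))
      (g.payoff p.2 - pr (obsAvg X S n (g.obsHist n p.1)))).trans
      (mul_le_mul (hgapK n p.1) h1 (norm_nonneg _) (hK0 n p.1))
    have h3 : |1 / ((n : ℝ) + 1)| ≤ 1 := by
      rw [abs_of_pos (hη n), div_le_one (by positivity)]
      linarith [(Nat.cast_nonneg n : (0 : ℝ) ≤ n)]
    exact (abs_sub _ _).trans (add_le_add h2 h3)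
  have hZmean : ∀ n h, ∫ r, Z n (h, r) ∂(g.roundSucc σ ν n h) ≤ 0 := fun n h => by
    set u := gap n (g.obsHist n h) with hu
    set y := obsAvg X S n (g.obsHist n h) with hy
    have hint : Integrable (fun r => (inner ℝ u (g.payoff r) : ℝ)) (g.roundSucc σ ν n h) :=
      Integrable.of_bound (measurable_const.inner g.measurable_payoff).aestronglyMeasurable
        (‖u‖ * K) (ae_of_all _ fun r => (norm_inner_le_norm _ _).trans
          (mul_le_mul_of_nonneg_left (hK _) (norm_nonneg _)))
    have h1 : ∫ r, Z n (h, r) ∂(g.roundSucc σ ν n h) =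
        ∫ r, inner ℝ u (g.payoff r) ∂(g.roundSucc σ ν n h) -
          (inner ℝ u (pr y) + 1 / ((n : ℝ) + 1)) := by
      simp only [Z, inner_sub_right, sub_sub, ← hu, ← hy]
      rw [integral_sub hint (integrable_const _)]
      simp
    have h2 : ∫ r, inner ℝ u (g.payoff r) ∂(g.roundSucc σ ν n h) ≤
        g.expectedValue u + 1 / ((n : ℝ) + 1) := by
      rw [g.integral_roundSucc hmon hK]
      have hval := g.integrable_gameValue_meanPayoff hK u
      calc _ ≤ ∫ x, gameValue (g.meanPayoff u x) + 1 / ((n : ℝ) + 1) ∂g.law.fst := by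
            refine integral_mono (g.integrable_sum_strategies hK σ ν n h u)
              (hval.add (integrable_const _)) fun x => ?_
            simp only [σ, simplexKernel_real_singleton]
            rw [sum_sum_swap_mul]
            exact sum_mul_le_of_mem_stdSimplex (real_singleton_mem_stdSimplex _) fun b =>
              (hP n _ b).le
        _ = _ := by
            rw [integral_add hval (integrable_const _)]
            simp [expectedValue]
    -- The hypothesis is applied to the half-space supporting `C` at the projection of the current
    -- average.
    have h3 := hC u (inner ℝ u (pr y)) fun c hc => hsupp y c hc
    linarith
  have hlln := ae_forall_eventually_partial_sum_le (g.roundZero σ ν) (g.roundSucc σ ν) hZm hZK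
    hZmean (w := fun T n => ((n : ℝ) + 1) / T) fun T n hn => by
      have hT : (0 : ℝ) < T := by exact_mod_cast (Nat.zero_le _).trans_lt hn
      refine ⟨by positivity, ?_⟩
      rw [div_le_one hT]
      exact_mod_cast hn
  filter_upwards [hlln] with ω hω
  refine tendsto_infDist_of_recursion (K := K)
    (Z := fun n => Z n (Preorder.frestrictLe n ω, ω (n + 1)))
    (fun _ => Metric.infDist_nonneg) ?_ (fun n => ?_) hω
  · exact (Metric.infDist_le_dist_of_mem h0).trans
      (by simpa using g.norm_avgPayoff_le hK 0 ω)
  · have h1 := mul_infDist_sq_le hmem hdist h0 (T := (n : ℝ) + 1) (by positivity)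
      (g.norm_avgPayoff_le hK n ω) (hK (ω (n + 1))) (g.avgPayoff_succ n ω)
    simpa only [Z, gap, obsAvg_obsHist, sub_add_cancel] using h1

end ContextGame

/-! ## Blackwell's condition is necessary -/

lemma le_of_eventually_mul_le {v r D : ℝ} {d : ℕ → ℝ} (hd : Tendsto d atTop (𝓝 0))
    (h : ∀ᶠ T : ℕ in atTop, T * v - D ≤ ((T : ℝ) + 1) * (r + d (T + 1))) : v ≤ r := by
  have hinv := tendsto_one_div_add_atTop_nhds_zero_nat (𝕜 := ℝ)
  have h1 : Tendsto (fun T : ℕ => v - (v + D) * (1 / ((T : ℝ) + 1))) atTop (𝓝 v) := by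
    have := (hinv.const_mul (v + D)).const_sub v
    rwa [mul_zero, sub_zero] at this
  have h2 : Tendsto (fun T : ℕ => r + d (T + 1)) atTop (𝓝 r) := by
    have := (hd.comp (tendsto_add_atTop_nat 1)).const_add r
    rwa [add_zero] at this
  refine le_of_tendsto_of_tendsto h1 h2 ?_
  filter_upwards [h] with T hT
  have hpos : (0 : ℝ) < (T : ℝ) + 1 := by positivity
  refine le_of_mul_le_mul_left (le_trans (le_of_eq ?_) hT) hpos
  field_simp
  ring

namespace ContextGame

variable {X S A B ι : Type*} [MeasurableSpace X] [MeasurableSpace S]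
  [MeasurableSpace A] [MeasurableSpace B]
  [Fintype S] [Nonempty S] [MeasurableSingletonClass S]
  [Fintype A] [Nonempty A] [MeasurableSingletonClass A]
  [Fintype B] [Nonempty B] [MeasurableSingletonClass B] [Fintype ι]

/-- Every half-space containing an approachable set is approachable: Nature can secure the
expected value in every direction by playing round by round. -/
theorem expectedValue_le_of_approachable (g : ContextGame X S A B X ι)
    (hmon : g.monitor = Prod.fst) {K : ℝ} (hK : ∀ r, ‖g.payoff r‖ ≤ K)
    {C : Set (EuclideanSpace ℝ ι)} (hne : C.Nonempty) (hC : g.Approachable C)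
    {u : EuclideanSpace ℝ ι} {r : ℝ} (hr : ∀ c ∈ C, inner ℝ u c ≤ r) :
    g.expectedValue u ≤ r := by
  obtain ⟨σ, hσ⟩ := hC
  refine le_of_forall_pos_le_add fun η hη => ?_
  obtain ⟨P, hPm, hP⟩ := exists_measurable_column_strategy (A := A) (B := B) (half_pos hη)
  have hstrat : Measurable (fun x => P (g.meanPayoff u x)) :=
    hPm.comp (g.measurable_meanPayoff.comp
      (g := fun p : EuclideanSpace ℝ ι × X => g.meanPayoff p.1 p.2)
      (f := fun x : X => (u, x)) measurable_prodMk_left)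
  -- A stationary strategy: near-optimal in the fixed direction `u`, ignoring the past.
  let ν : NatureStrategy X S A B X :=
    { first := simplexKernel _ hstrat
      next := fun n => simplexKernel _ (hstrat.comp measurable_snd)
      isMarkov_first := inferInstance
      isMarkov_next := fun n => inferInstance }
  set V := g.expectedValue u with hV
  let Z : (n : ℕ) → ((_ : Finset.Iic n) → Round X S A B) × Round X S A B → ℝ := fun n p =>
    (V - η / 2) - inner ℝ u (g.payoff p.2)
  have hm : Measurable (fun q => (inner ℝ u (g.payoff q) : ℝ)) :=
    measurable_const.inner g.measurable_payoff
  have hb : ∀ q, ‖(inner ℝ u (g.payoff q) : ℝ)‖ ≤ ‖u‖ * K := fun q =>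
    (norm_inner_le_norm _ _).trans (mul_le_mul_of_nonneg_left (hK _) (norm_nonneg _))
  have hZm : ∀ n, Measurable (Z n) := fun n => (hm.comp measurable_snd).const_sub _
  have hZK : ∀ n p, |Z n p| ≤ |V - η / 2| + ‖u‖ * K := fun n p =>
    (abs_sub _ _).trans (add_le_add le_rfl (hb _))
  have hZmean : ∀ n h, ∫ q, Z n (h, q) ∂(g.roundSucc σ ν n h) ≤ 0 := fun n h => by
    have hint : Integrable (fun q => (inner ℝ u (g.payoff q) : ℝ)) (g.roundSucc σ ν n h) :=
      Integrable.of_bound hm.aestronglyMeasurable (‖u‖ * K) (ae_of_all _ hb)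
    have h1 : ∫ q, Z n (h, q) ∂(g.roundSucc σ ν n h) =
        V - η / 2 - ∫ q, inner ℝ u (g.payoff q) ∂(g.roundSucc σ ν n h) := by
      simp only [Z]
      rw [integral_sub (integrable_const _) hint]
      simp
    have h2 : V - η / 2 ≤ ∫ q, inner ℝ u (g.payoff q) ∂(g.roundSucc σ ν n h) := by
      rw [g.integral_roundSucc hmon hK]
      have hval := g.integrable_gameValue_meanPayoff hK u
      calc V - η / 2 = ∫ x, gameValue (g.meanPayoff u x) - η / 2 ∂g.law.fst := by
            rw [integral_sub hval (integrable_const _)]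
            simp [hV, expectedValue]
        _ ≤ _ := by
            refine integral_mono (hval.sub (integrable_const _))
              (g.integrable_sum_strategies hK σ ν n h u) fun x => ?_
            simp only [ν, simplexKernel_real_singleton]
            exact le_sum_mul_of_mem_stdSimplex (real_singleton_mem_stdSimplex _) fun a =>
              (hP _ a).le
    linarith
  have hlln := ae_forall_eventually_partial_sum_le (g.roundZero σ ν) (g.roundSucc σ ν) hZm hZK
    hZmean (w := fun _ _ => 1) fun _ _ _ => ⟨zero_le_one, le_rfl⟩
  have hprob : IsProbabilityMeasure (g.playLaw σ ν) := by unfold playLaw; infer_instance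
  -- The conclusion is deterministic, so a single trajectory with both almost sure properties
  -- suffices.
  obtain ⟨ω, hω, hdist⟩ := (hlln.and (hσ ν)).exists
  suffices h : V - η ≤ r by linarith
  have hdist' : Tendsto (fun T => ‖u‖ * Metric.infDist (g.avgPayoff T ω) C) atTop (𝓝 0) := by
    simpa using hdist.const_mul ‖u‖
  refine le_of_eventually_mul_le (D := ‖u‖ * K) hdist' ?_
  filter_upwards [hω (η / 2) (half_pos hη)] with T hT
  have hsum : ((T : ℝ) + 1) * inner ℝ u (g.avgPayoff (T + 1) ω) =
      (∑ n ∈ Finset.range T, inner ℝ u (g.payoff (ω (n + 1)))) + inner ℝ u (g.payoff (ω 0)) := by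
    rw [avgPayoff, inner_smul_right, inner_sum, Finset.sum_range_succ']
    push_cast
    rw [mul_inv_cancel_left₀ (by positivity)]
  have h0 := (abs_le.1 (hb (ω 0))).1
  have hinner : inner ℝ u (g.avgPayoff (T + 1) ω) ≤
      r + ‖u‖ * Metric.infDist (g.avgPayoff (T + 1) ω) C := by
    refine le_of_forall_pos_le_add fun ε hε => ?_
    obtain ⟨c, hc, hcd⟩ := (Metric.infDist_lt_iff hne).1
      (lt_add_of_pos_right (Metric.infDist (g.avgPayoff (T + 1) ω) C)
        -- The `+ 1` covers u = 0.
        (show 0 < ε / (‖u‖ + 1) by positivity))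
    have h1 : inner ℝ u (g.avgPayoff (T + 1) ω) =
        inner ℝ u c + inner ℝ u (g.avgPayoff (T + 1) ω - c) := by
      rw [inner_sub_right]; ring
    have h2 := (real_inner_le_norm u (g.avgPayoff (T + 1) ω - c)).trans
      (mul_le_mul_of_nonneg_left ((dist_eq_norm _ _).symm.trans_le hcd.le) (norm_nonneg u))
    have h3 : ‖u‖ * (ε / (‖u‖ + 1)) ≤ ε := by
      rw [← mul_div_assoc, div_le_iff₀ (by positivity)]
      nlinarith [norm_nonneg u]
    have h4 := hr c hc
    rw [mul_add] at h2
    linarith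
  simp only [Z, one_mul, Finset.sum_sub_distrib, Finset.sum_const, Finset.card_range,
    nsmul_eq_mul] at hT
  have h5 := mul_le_mul_of_nonneg_left hinner (show (0 : ℝ) ≤ (T : ℝ) + 1 by positivity)
  nlinarith

end ContextGame

/-! ## Total variation distance -/

section TotalVariation

variable {X : Type*} [MeasurableSpace X] (P P' : Measure X) [IsProbabilityMeasure P]
  [IsProbabilityMeasure P']

lemma abs_measureReal_sub_le_tvDist {E : Set X} (hE : MeasurableSet E) :
    |P.real E - P'.real E| ≤ tvDist P P' := by
  refine le_ciSup (f := fun E : {E : Set X // MeasurableSet E} => |P.real E.1 - P'.real E.1|)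
    ⟨1, ?_⟩ ⟨E, hE⟩
  rintro _ ⟨F, rfl⟩
  rw [abs_le]
  constructor <;>
  linarith [measureReal_le_one (μ := P) (s := F.1), measureReal_le_one (μ := P') (s := F.1),
    measureReal_nonneg (μ := P) (s := F.1), measureReal_nonneg (μ := P') (s := F.1)]

lemma tvDist_nonneg : 0 ≤ tvDist P P' :=
  (abs_nonneg _).trans (abs_measureReal_sub_le_tvDist P P' MeasurableSet.empty)

/-- Passing to the complement of `E` changes the sign of the difference. -/
lemma tvDist_le {c : ℝ} (h : ∀ E, MeasurableSet E → P.real E - P'.real E ≤ c) :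
    tvDist P P' ≤ c := by
  have : Nonempty {E : Set X // MeasurableSet E} := ⟨⟨∅, MeasurableSet.empty⟩⟩
  refine ciSup_le fun E => abs_le.2 ⟨?_, h E.1 E.2⟩
  have := h _ E.2.compl
  rw [probReal_compl_eq_one_sub E.2, probReal_compl_eq_one_sub E.2] at this
  linarith

/-- Layer cake: `f` is the average over t ∈ (0, 1] of the indicators of {t < f}, and each of them
contributes at most the total variation. -/
lemma abs_integral_sub_integral_le_tvDist {f : X → ℝ} (hf : Measurable f)
    (hf01 : ∀ x, f x ∈ Set.Icc (0 : ℝ) 1) :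
    |(∫ x, f x ∂P) - (∫ x, f x ∂P')| ≤ tvDist P P' := by
  have key : ∀ (μ : Measure X) [IsProbabilityMeasure μ],
      ∫ x, f x ∂μ = ∫ t in Set.Ioc (0 : ℝ) 1, μ.real {x | t < f x} := fun μ _ => by
    have hint : Integrable f μ := Integrable.of_bound hf.aestronglyMeasurable 1
      (ae_of_all _ fun x => by
        rw [Real.norm_of_nonneg (hf01 x).1]; exact (hf01 x).2)
    rw [hint.integral_eq_integral_meas_lt (ae_of_all _ fun x => (hf01 x).1)]
    refine (setIntegral_eq_of_subset_of_forall_sdiff_eq_zero measurableSet_Ioi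
      Set.Ioc_subset_Ioi_self fun t ht => ?_)
    have ht1 : 1 < t := not_le.1 fun h => ht.2 ⟨ht.1, h⟩
    have : {x | t < f x} = ∅ :=
      Set.eq_empty_of_forall_notMem fun x hx => absurd hx (not_lt.2 ((hf01 x).2.trans ht1.le))
    rw [this, measureReal_empty]
  have hanti : ∀ (μ : Measure X) [IsProbabilityMeasure μ],
      IntegrableOn (fun t => μ.real {x | t < f x}) (Set.Ioc (0 : ℝ) 1) := fun μ _ => by
    have : Antitone (fun t => μ.real {x | t < f x}) := fun s t hst =>
      measureReal_mono (fun x hx => lt_of_le_of_lt hst hx) (measure_ne_top _ _)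
    exact (this.antitoneOn _).integrableOn_isCompact isCompact_Icc |>.mono_set
      Set.Ioc_subset_Icc_self
  rw [key P, key P', ← integral_sub (hanti P) (hanti P'), ← Real.norm_eq_abs]
  refine (norm_setIntegral_le_of_norm_le_const (C := tvDist P P') (by simp) fun t _ => ?_).trans
    (by simp)
  exact abs_measureReal_sub_le_tvDist P P' (measurableSet_lt measurable_const hf)

end TotalVariation

/-! ## The conditional laws of the groups -/

section Groups

variable {X : Type*} [MeasurableSpace X] (Q : Measure (X × Fin 2)) [IsProbabilityMeasure Q]

/-- The density of the law of a group with respect to the law of the non-sensitive context. -/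
noncomputable def groupDensity (s : Fin 2) (x : X) : ℝ :=
  (Q.condKernel x).real {s} / groupProb Q s

lemma groupDensity_nonneg (s : Fin 2) (x : X) : 0 ≤ groupDensity Q s x :=
  div_nonneg measureReal_nonneg measureReal_nonneg

lemma measurable_groupDensity (s : Fin 2) : Measurable (groupDensity Q s) :=
  (Kernel.measurable_coe _ (measurableSet_singleton s)).ennreal_toReal.div_const _

lemma measurableSet_group (s : Fin 2) :
    MeasurableSet (Prod.snd ⁻¹' {s} : Set (X × Fin 2)) :=
  measurable_snd (measurableSet_singleton s)

variable {Q}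

lemma isProbabilityMeasure_groupLaw {s : Fin 2} (hs : 0 < groupProb Q s) :
    IsProbabilityMeasure (groupLaw Q s) := by
  have h : Q (Prod.snd ⁻¹' {s}) ≠ 0 := fun h => by simp [groupProb, Measure.real, h] at hs
  have := cond_isProbabilityMeasure h
  exact Measure.isProbabilityMeasure_map measurable_fst.aemeasurable

lemma groupDensity_le {s : Fin 2} (hs : 0 < groupProb Q s) (x : X) :
    groupDensity Q s x ≤ 1 / groupProb Q s :=
  div_le_div_of_nonneg_right measureReal_le_one hs.le

lemma integrable_groupDensity_mul {s : Fin 2} (hs : 0 < groupProb Q s) {f : X → ℝ}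
    (hf : Measurable f) {L : ℝ} (hL : ∀ x, |f x| ≤ L) :
    Integrable (fun x => groupDensity Q s x * f x) Q.fst :=
  Integrable.of_bound ((measurable_groupDensity Q s).mul hf).aestronglyMeasurable
    (1 / groupProb Q s * L) (ae_of_all _ fun x => by
      rw [norm_mul, Real.norm_of_nonneg (groupDensity_nonneg Q s x), Real.norm_eq_abs]
      exact mul_le_mul (groupDensity_le hs x) (hL x) (abs_nonneg _) (by positivity))

/-- Bayes' rule: disintegrating the indicator of group `s` along `x` produces its posterior weight,
and conditioning divides by γ_s. -/
lemma integral_groupDensity_mul {s : Fin 2} (hs : 0 < groupProb Q s) {f : X → ℝ}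
    (hf : Measurable f) {L : ℝ} (hL : ∀ x, |f x| ≤ L) :
    ∫ x, groupDensity Q s x * f x ∂Q.fst = ∫ x, f x ∂(groupLaw Q s) := by
  have hind : Integrable ((Prod.snd ⁻¹' {s}).indicator fun p : X × Fin 2 => f p.1) Q :=
    (Integrable.of_bound (hf.comp measurable_fst).aestronglyMeasurable L
      (ae_of_all _ fun p => hL p.1)).indicator (measurableSet_group s)
  have h1 : ∫ p, (Prod.snd ⁻¹' {s}).indicator (fun p : X × Fin 2 => f p.1) p ∂Q =
      ∫ x, (Q.condKernel x).real {s} * f x ∂Q.fst := by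
    conv_lhs => rw [← Q.disintegrate Q.condKernel]
    rw [Measure.integral_compProd (by rwa [Q.disintegrate Q.condKernel])]
    refine integral_congr_ae (ae_of_all _ fun x => ?_)
    simp only
    rw [integral_fintype Integrable.of_finite]
    fin_cases s <;> simp [Set.indicator]
  rw [groupLaw, integral_map measurable_fst.aemeasurable hf.aestronglyMeasurable,
    ProbabilityTheory.cond, integral_smul_measure, ← integral_indicator (measurableSet_group s), h1]
  simp only [groupDensity, div_eq_inv_mul, mul_assoc]
  rw [integral_const_mul, ENNReal.toReal_inv, smul_eq_mul]
  rfl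

end Groups

/-! ## Rounding to the forecast grid -/

section Grid

variable {N : ℕ}

/-- Truncation to the range of the forecast grid. -/
noncomputable def clipGrid (N : ℕ) (q : ℝ) : ℝ := max (1 / (2 * N)) (min (1 - 1 / (2 * N)) q)

lemma measurable_clipGrid : Measurable (clipGrid N) := by
  unfold clipGrid; fun_prop

lemma one_div_two_mul_le (hN : 0 < N) : (1 : ℝ) / (2 * N) ≤ 1 - 1 / (2 * N) := by
  have : (1 : ℝ) ≤ N := by exact_mod_cast hN
  have h : (1 : ℝ) / (2 * N) ≤ 1 / 2 := one_div_le_one_div_of_le (by norm_num) (by linarith)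
  linarith

lemma clipGrid_mem_Icc (hN : 0 < N) (q : ℝ) : clipGrid N q ∈ Set.Icc (0 : ℝ) 1 := by
  have h := one_div_two_mul_le hN
  have h0 : (0 : ℝ) ≤ 1 / (2 * N) := by positivity
  exact ⟨h0.trans (le_max_left _ _),
    max_le (by linarith) ((min_le_left _ _).trans (by linarith))⟩

/-- Randomised rounding between neighbouring grid points. -/
lemma exists_rounding (hN : 0 < N) {q : ℝ} (hq : q ∈ Set.Icc (0 : ℝ) 1) :
    ∃ i j : Fin N, ∃ θ ∈ Set.Icc (0 : ℝ) 1,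
      (1 - θ) * gridPoint N i + θ * gridPoint N j = clipGrid N q ∧
      (1 - θ) * |gridPoint N i - q| + θ * |gridPoint N j - q| ≤ 1 / (2 * N) := by
  have hN' : (0 : ℝ) < N := by exact_mod_cast hN
  have hle := one_div_two_mul_le hN
  have h0 : (0 : ℝ) ≤ 1 / (2 * N) := by positivity
  rcases le_or_gt q (1 / (2 * (N : ℝ))) with h | h
  · have ha : gridPoint N ⟨0, hN⟩ = 1 / (2 * N) := by simp [gridPoint]; ring
    have hc : clipGrid N q = 1 / (2 * N) := max_eq_left ((min_le_right _ _).trans h)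
    refine ⟨⟨0, hN⟩, ⟨0, hN⟩, 0, ⟨le_rfl, zero_le_one⟩, by rw [ha, hc]; ring, ?_⟩
    rw [ha, abs_of_nonneg (by linarith)]
    linarith [hq.1]
  rcases le_or_gt (1 - 1 / (2 * (N : ℝ))) q with h' | h'
  · have ha : gridPoint N ⟨N - 1, by omega⟩ = 1 - 1 / (2 * N) := by
      simp only [gridPoint]
      rw [Nat.cast_sub hN]
      field_simp
      push_cast
      ring
    have hc : clipGrid N q = 1 - 1 / (2 * N) := by
      rw [clipGrid, min_eq_left h', max_eq_right hle]
    refine ⟨⟨N - 1, by omega⟩, ⟨N - 1, by omega⟩, 0, ⟨le_rfl, zero_le_one⟩,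
      by rw [ha, hc]; ring, ?_⟩
    rw [ha, abs_of_nonpos (by linarith)]
    linarith [hq.2]
  have hc : clipGrid N q = q := by rw [clipGrid, min_eq_right h'.le, max_eq_right h.le]
  have ht0 : 0 ≤ N * q - 1 / 2 := by
    rw [div_lt_iff₀ (by positivity)] at h; linarith
  have ht1 : N * q - 1 / 2 < N - 1 := by
    have : 1 / (2 * (N : ℝ)) * N = 1 / 2 := by field_simp
    nlinarith
  set i := ⌊N * q - 1 / 2⌋₊ with hi
  have hi1 : (i : ℝ) ≤ N * q - 1 / 2 := Nat.floor_le ht0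
  have hi2 : N * q - 1 / 2 < i + 1 := Nat.lt_floor_add_one _
  have hiN : i + 1 < N := by
    have : (i : ℝ) + 1 < N := by linarith
    exact_mod_cast this
  -- `θ` is the position of `q` within its grid cell. The mean error is then 2θ(1-θ)/N, largest at θ
  -- = 1/2.
  set θ := N * q - 1 / 2 - i with hθ
  have hθ0 : 0 ≤ θ := by linarith
  have hθ1 : θ ≤ 1 := by linarith
  have e1 : gridPoint N ⟨i, by omega⟩ = q - θ / N := by
    simp only [gridPoint, hθ]; field_simp; ring
  have e2 : gridPoint N ⟨i + 1, hiN⟩ = q + (1 - θ) / N := by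
    simp only [gridPoint, hθ]; push_cast; field_simp; ring
  refine ⟨⟨i, by omega⟩, ⟨i + 1, hiN⟩, θ, ⟨hθ0, hθ1⟩, ?_, ?_⟩
  · rw [e1, e2, hc]; ring
  · rw [e1, e2, show q - θ / N - q = -(θ / N) by ring, add_sub_cancel_left, abs_neg,
      abs_of_nonneg (by positivity), abs_of_nonneg (div_nonneg (by linarith) hN'.le)]
    rw [show (1 - θ) * (θ / N) + θ * ((1 - θ) / N) = (4 * θ * (1 - θ)) * (1 / (2 * N)) by ring]
    nlinarith [sq_nonneg (2 * θ - 1)]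

lemma exists_abs_gridPoint_sub_le (hN : 0 < N) {q : ℝ} (hq : q ∈ Set.Icc (0 : ℝ) 1) :
    ∃ i : Fin N, |gridPoint N i - q| ≤ 1 / (2 * N) := by
  obtain ⟨i, j, θ, hθ, -, h⟩ := exists_rounding hN hq
  by_contra! hcon
  rcases hθ.1.eq_or_lt with h0 | h0
  · rw [← h0] at h; linarith [hcon i]
  · nlinarith [hcon i, hcon j, hθ.2, mul_lt_mul_of_pos_left (hcon j) h0,
      mul_le_mul_of_nonneg_left (hcon i).le (sub_nonneg.2 hθ.2)]

end Grid

/-! ## The calibration game -/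

section CalibrationGame

variable {X : Type*} [MeasurableSpace X] {Q : Measure (X × Fin 2)} {N : ℕ}

lemma inner_calIdx (u c : EuclideanSpace ℝ (CalIdx N)) :
    inner ℝ u c = (∑ j : Fin 2 × Fin N, u (Sum.inl j) * c (Sum.inl j)) +
      (u (Sum.inr 0) * c (Sum.inr 0) + u (Sum.inr 1) * c (Sum.inr 1)) := by
  simp [PiLp.inner_apply, Fintype.sum_sum_type, mul_comm]

lemma inner_calDPVec (u : EuclideanSpace ℝ (CalIdx N)) (s : Fin 2) (k : Fin N) (b : Fin 2) :
    inner ℝ u (calDPVec Q N s k b) = (u (Sum.inl (s, k)) * (gridPoint N k - ((b : ℕ) : ℝ)) +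
      u (Sum.inr s) * gridPoint N k) / groupProb Q s := by
  have h : ∑ j : Fin 2 × Fin N, u (Sum.inl j) * calDPVec Q N s k b (Sum.inl j) =
      u (Sum.inl (s, k)) * ((gridPoint N k - ((b : ℕ) : ℝ)) / groupProb Q s) := by
    rw [Finset.sum_eq_single (s, k)]
    · simp [calDPVec]
    · rintro ⟨s', k'⟩ - hne
      have : ¬ (s = s' ∧ k = k') := fun h => hne (by rw [h.1, h.2])
      simp [calDPVec, this]
    · simp
  rw [inner_calIdx, h]
  fin_cases s <;> simp [calDPVec] <;> ring

lemma exists_norm_calDPVec_le (Q : Measure (X × Fin 2)) (N : ℕ) :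
    ∃ K, ∀ s k b, ‖calDPVec Q N s k b‖ ≤ K := by
  obtain ⟨K, hK⟩ := (Set.finite_range
    (fun p : Fin 2 × Fin N × Fin 2 => ‖calDPVec Q N p.1 p.2.1 p.2.2‖)).bddAbove
  exact ⟨K, fun s k b => hK ⟨(s, k, b), rfl⟩⟩

lemma zero_mem_calDPTarget {ε δ : ℝ} (hε : 0 ≤ ε) (hδ : 0 ≤ δ) : 0 ∈ calDPTarget N ε δ := by
  simp [calDPTarget, hε, hδ]

lemma isClosed_calDPTarget (ε δ : ℝ) : IsClosed (calDPTarget N ε δ) := by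
  have h1 : IsClosed {v : EuclideanSpace ℝ (CalIdx N) |
      ∑ j : Fin 2 × Fin N, |v (Sum.inl j)| ≤ ε} := isClosed_le (by fun_prop) continuous_const
  have h2 : IsClosed {v : EuclideanSpace ℝ (CalIdx N) |
      |v (Sum.inr 0) - v (Sum.inr 1)| ≤ δ} := isClosed_le (by fun_prop) continuous_const
  exact h1.inter h2

lemma convex_calDPTarget (ε δ : ℝ) : Convex ℝ (calDPTarget N ε δ) := by
  rintro v ⟨hv1, hv2⟩ w ⟨hw1, hw2⟩ a b ha hb hab
  constructor
  · calc _ ≤ ∑ j : Fin 2 × Fin N, (a * |v (Sum.inl j)| + b * |w (Sum.inl j)|) := by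
          refine Finset.sum_le_sum fun j _ => ?_
          refine (abs_add_le _ _).trans (le_of_eq ?_)
          simp [abs_mul, abs_of_nonneg ha, abs_of_nonneg hb]
      _ = a * ∑ j : Fin 2 × Fin N, |v (Sum.inl j)| + b * ∑ j : Fin 2 × Fin N, |w (Sum.inl j)| := by
          rw [Finset.sum_add_distrib, Finset.mul_sum, Finset.mul_sum]
      _ ≤ a * ε + b * ε := by gcongr
      _ = ε := by rw [← add_mul, hab, one_mul]
  · have : (a • v + b • w) (Sum.inr 0) - (a • v + b • w) (Sum.inr 1) =
        a * (v (Sum.inr 0) - v (Sum.inr 1)) + b * (w (Sum.inr 0) - w (Sum.inr 1)) := by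
      simp; ring
    rw [this]
    calc _ ≤ a * |v (Sum.inr 0) - v (Sum.inr 1)| + b * |w (Sum.inr 0) - w (Sum.inr 1)| := by
          refine (abs_add_le _ _).trans (le_of_eq ?_)
          simp [abs_mul, abs_of_nonneg ha, abs_of_nonneg hb]
      _ ≤ a * δ + b * δ := by gcongr
      _ = δ := by rw [← add_mul, hab, one_mul]

/-- ℓ¹/ℓ^∞ duality on the calibration block; the opposite parity coordinates of `u` see only the
difference bounded by `δ`. -/
lemma inner_le_of_mem_calDPTarget {ε δ Λ : ℝ} {u c : EuclideanSpace ℝ (CalIdx N)}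
    (hΛ0 : 0 ≤ Λ) (hΛ : ∀ j, |u (Sum.inl j)| ≤ Λ) (hu : u (Sum.inr 1) = -u (Sum.inr 0))
    (hc : c ∈ calDPTarget N ε δ) : inner ℝ u c ≤ ε * Λ + δ * |u (Sum.inr 0)| := by
  have h1 : ∑ j : Fin 2 × Fin N, u (Sum.inl j) * c (Sum.inl j) ≤ ε * Λ := by
    calc _ ≤ ∑ j : Fin 2 × Fin N, Λ * |c (Sum.inl j)| := by
          refine Finset.sum_le_sum fun j _ => (le_abs_self _).trans ?_
          rw [abs_mul]
          exact mul_le_mul_of_nonneg_right (hΛ j) (abs_nonneg _)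
      _ ≤ ε * Λ := by
          rw [← Finset.mul_sum, mul_comm]
          exact mul_le_mul_of_nonneg_right hc.1 hΛ0
  have h2 : u (Sum.inr 0) * (c (Sum.inr 0) - c (Sum.inr 1)) ≤ δ * |u (Sum.inr 0)| := by
    refine (le_abs_self _).trans ?_
    rw [abs_mul, mul_comm]
    exact mul_le_mul_of_nonneg_right hc.2 (abs_nonneg _)
  rw [inner_calIdx, hu]
  linarith

lemma le_of_forall_mem_calDPTarget {ε δ r : ℝ} (hε : 0 ≤ ε) (hδ : 0 ≤ δ)
    {u : EuclideanSpace ℝ (CalIdx N)} (hr : ∀ c ∈ calDPTarget N ε δ, inner ℝ u c ≤ r) :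
    u (Sum.inr 1) = -u (Sum.inr 0) ∧
      ∀ j, ε * |u (Sum.inl j)| + δ * |u (Sum.inr 0)| ≤ r := by
  constructor
  · by_contra hne
    have hne' : u (Sum.inr 0) + u (Sum.inr 1) ≠ 0 := fun h => hne (by linarith)
    -- The target contains the parity diagonal; this point of it has inner product r + 1 with `u`.
    set t := (r + 1) / (u (Sum.inr 0) + u (Sum.inr 1)) with ht
    have h := hr (WithLp.toLp 2 (Sum.elim (fun _ => 0) (fun _ => t))) (by
      simp [calDPTarget, hε, hδ])
    rw [inner_calIdx] at h
    simp only [Sum.elim_inl, mul_zero, Finset.sum_const_zero, Sum.elim_inr, zero_add] at h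
    rw [← add_mul, ht, mul_div_cancel₀ _ hne'] at h
    linarith
  · intro j
    -- All the calibration budget goes to coordinate `j` and all the parity budget to group 0, with
    -- the signs of `u`.
    have h := hr (WithLp.toLp 2 (Sum.elim (Pi.single j (ε * SignType.sign (u (Sum.inl j))))
      (Pi.single 0 (δ * SignType.sign (u (Sum.inr 0)))))) (by
      have hs : ∀ x : ℝ, |((SignType.sign x : SignType) : ℝ)| ≤ 1 := fun x => by
        rcases lt_trichotomy x 0 with h | h | h <;> simp [h]
      constructor
      · rw [Finset.sum_eq_single j]
        · simp only [Sum.elim_inl, Pi.single_eq_same, abs_mul, abs_of_nonneg hε]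
          exact mul_le_of_le_one_right hε (hs _)
        · intro i _ hi
          simp [Pi.single_eq_of_ne hi]
        · simp
      · simp only [Sum.elim_inr, Pi.single_eq_same, abs_mul, abs_of_nonneg hδ, sub_zero,
          Pi.single_eq_of_ne (show (1 : Fin 2) ≠ 0 by decide)]
        exact mul_le_of_le_one_right hδ (hs _))
    rw [inner_calIdx, Finset.sum_eq_single j] at h
    · simp only [Sum.elim_inl, Sum.elim_inr, Pi.single_eq_same,
        Pi.single_eq_of_ne (show (1 : Fin 2) ≠ 0 by decide), mul_zero, add_zero] at h
      have e : ∀ x : ℝ, x * ((SignType.sign x : SignType) : ℝ) = |x| := fun x => by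
        rw [mul_comm]; exact sign_mul_self x
      rw [mul_left_comm, e, mul_left_comm, e] at h
      exact h
    · intro i _ hi
      simp [Pi.single_eq_of_ne hi]
    · simp

variable (Q N) [IsProbabilityMeasure Q] [Nonempty (Fin N)]

/-- Blackwell's dual condition for the calibration game. -/
def CalDPDual (ε δ : ℝ) : Prop :=
  ∀ (u : EuclideanSpace ℝ (CalIdx N)) (Λ : ℝ), 0 ≤ Λ → (∀ j, |u (Sum.inl j)| ≤ Λ) →
    u (Sum.inr 1) = -u (Sum.inr 0) →
    ∫ x, gameValue ((calDPGame Q N Prod.fst measurable_fst).meanPayoff u x) ∂Q.fst ≤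
      ε * Λ + δ * |u (Sum.inr 0)|

variable {Q N}

theorem achievable_iff {ε δ : ℝ} :
    Achievable Q N (Prod.fst : X × Fin 2 → X) measurable_fst ε δ ↔
      0 ≤ ε ∧ 0 ≤ δ ∧ CalDPDual Q N ε δ := by
  obtain ⟨K, hK⟩ := exists_norm_calDPVec_le Q N
  refine and_congr_right fun hε => and_congr_right fun hδ => ⟨fun h u Λ hΛ0 hΛ hu => ?_, fun h => ?_⟩
  · exact ContextGame.expectedValue_le_of_approachable (calDPGame Q N Prod.fst measurable_fst) rfl
      (fun r => hK r.1.2 r.2.1 r.2.2) ⟨0, zero_mem_calDPTarget hε hδ⟩ h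
      fun c hc => inner_le_of_mem_calDPTarget hΛ0 hΛ hu hc
  · refine ContextGame.approachable_of_expectedValue_le (calDPGame Q N Prod.fst measurable_fst) rfl
      (fun r => hK r.1.2 r.2.1 r.2.2) (zero_mem_calDPTarget hε hδ) (isClosed_calDPTarget ε δ)
      (convex_calDPTarget ε δ) fun u r hr => ?_
    obtain ⟨hu, hle⟩ := le_of_forall_mem_calDPTarget hε hδ hr
    obtain ⟨j, hj⟩ := Finite.exists_max fun j : Fin 2 × Fin N => |u (Sum.inl j)|
    exact (h u _ (abs_nonneg _) hj hu).trans (hle j)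

lemma isClosed_setOf_achievable (δ : ℝ) :
    IsClosed {ε | Achievable Q N (Prod.fst : X × Fin 2 → X) measurable_fst ε δ} := by
  simp only [achievable_iff, CalDPDual, Set.ofPred_and, Set.ofPred_forall]
  refine isClosed_Ici.inter (isClosed_const.inter ?_)
  refine isClosed_iInter fun u => isClosed_iInter fun Λ => isClosed_iInter fun _ =>
    isClosed_iInter fun _ => isClosed_iInter fun _ => isClosed_le continuous_const (by fun_prop)

end CalibrationGame

/-! ### Lower and upper bounds through the dual condition -/

section CalibrationBounds

variable {X : Type*} [MeasurableSpace X] {Q : Measure (X × Fin 2)} {N : ℕ}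
  [IsProbabilityMeasure Q]

lemma meanPayoff_calDPGame (u : EuclideanSpace ℝ (CalIdx N)) (x : X) (k : Fin N) (b : Fin 2) :
    (calDPGame Q N Prod.fst measurable_fst).meanPayoff u x k b =
      ∑ s, groupDensity Q s x * (u (Sum.inl (s, k)) * (gridPoint N k - ((b : ℕ) : ℝ)) +
        u (Sum.inr s) * gridPoint N k) := by
  refine Finset.sum_congr rfl fun s _ => ?_
  change (Q.condKernel x).real {s} * inner ℝ u (calDPVec Q N s k b) = _
  rw [inner_calDPVec, groupDensity]
  ring

/-- The payoff is affine in the outcome, so only the probability of outcome 1 matters. -/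
lemma sum_mul_meanPayoff_calDPGame {q : Fin 2 → ℝ} (hq : q ∈ stdSimplex ℝ (Fin 2))
    (u : EuclideanSpace ℝ (CalIdx N)) (x : X) (k : Fin N) :
    ∑ b, q b * (calDPGame Q N Prod.fst measurable_fst).meanPayoff u x k b =
      ∑ s, groupDensity Q s x * (u (Sum.inl (s, k)) * (gridPoint N k - q 1) +
        u (Sum.inr s) * gridPoint N k) := by
  have h0 : q 0 = 1 - q 1 := by
    have := hq.2
    rw [Fin.sum_univ_two] at this
    linarith
  simp only [meanPayoff_calDPGame, Fin.sum_univ_two, h0]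
  simp
  ring

variable (hQ : ∀ s, 0 < groupProb Q s)

include hQ

lemma integral_sum_groupDensity_mul {f : Fin 2 → X → ℝ} (hf : ∀ s, Measurable (f s)) {L : ℝ}
    (hL : ∀ s x, |f s x| ≤ L) :
    ∫ x, ∑ s, groupDensity Q s x * f s x ∂Q.fst = ∑ s, ∫ x, f s x ∂(groupLaw Q s) := by
  rw [integral_finsetSum _ fun s _ => integrable_groupDensity_mul (hQ s) (hf s) (hL s)]
  exact Finset.sum_congr rfl fun s _ => integral_groupDensity_mul (hQ s) (hf s) (hL s)

lemma integrable_sum_groupDensity_mul {f : Fin 2 → X → ℝ} (hf : ∀ s, Measurable (f s)) {L : ℝ}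
    (hL : ∀ s x, |f s x| ≤ L) :
    Integrable (fun x => ∑ s, groupDensity Q s x * f s x) Q.fst :=
  integrable_finsetSum _ fun s _ => integrable_groupDensity_mul (hQ s) (hf s) (hL s)

variable [Nonempty (Fin N)]

/-- Nature can play the indicator of a set that separates the two groups. -/
theorem tvDist_le_of_calDPDual {ε δ : ℝ} (h : CalDPDual Q N ε δ) :
    tvDist (groupLaw Q 0) (groupLaw Q 1) ≤ ε + δ := by
  have hp0 := isProbabilityMeasure_groupLaw (hQ 0)
  have hp1 := isProbabilityMeasure_groupLaw (hQ 1)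
  obtain ⟨K, hK⟩ := exists_norm_calDPVec_le Q N
  refine tvDist_le _ _ fun E hE => ?_
  -- Calibration and parity signs are opposite within each group, so the forecast cancels and ±b
  -- remains.
  let u : EuclideanSpace ℝ (CalIdx N) := WithLp.toLp 2
    (Sum.elim (fun j => if j.1 = 0 then -1 else 1) (fun s => if s = 0 then 1 else -1))
  have hu := h u 1 zero_le_one (fun j => by simp only [u, Sum.elim_inl]; split_ifs <;> simp)
    (by simp [u])
  have hu0 : u (Sum.inr 0) = 1 := by simp [u]
  rw [hu0, abs_one, mul_one, mul_one] at hu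
  refine le_trans ?_ hu
  let f : Fin 2 → X → ℝ := fun s => E.indicator fun _ => if s = 0 then 1 else -1
  have hf : ∀ s, Measurable (f s) := fun s => measurable_const.indicator hE
  have hfL : ∀ s x, |f s x| ≤ 1 := fun s x => by
    by_cases hx : x ∈ E <;> fin_cases s <;> simp [f, hx]
  calc (groupLaw Q 0).real E - (groupLaw Q 1).real E
      = ∑ s, ∫ x, f s x ∂(groupLaw Q s) := by
        simp only [f, integral_indicator hE, setIntegral_const, Fin.sum_univ_two]
        simp
        ring
    _ = ∫ x, ∑ s, groupDensity Q s x * f s x ∂Q.fst :=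
        (integral_sum_groupDensity_mul hQ hf hfL).symm
    _ ≤ _ := by
        refine integral_mono (integrable_sum_groupDensity_mul hQ hf hfL)
          (ContextGame.integrable_gameValue_meanPayoff (calDPGame Q N Prod.fst measurable_fst)
            (fun r => hK r.1.2 r.2.1 r.2.2) u) fun x => ?_
        classical
        -- Nature plays outcome 1 exactly on `E`.
        refine le_gameValue (single_mem_stdSimplex ℝ (if x ∈ E then (1 : Fin 2) else 0))
          fun k => le_of_eq ?_
        rw [sum_mul_meanPayoff_calDPGame (single_mem_stdSimplex ℝ _)]
        by_cases hx : x ∈ E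
        · simp [u, f, hx, Fin.sum_univ_two]
          ring
        · simp [u, f, hx, Fin.sum_univ_two]

/-- The Player can answer every mixed action of Nature: either by rounding it to the grid, or by
playing a constant forecast. -/
theorem calDPDual_of_mem_Icc (hN : 0 < N) {τ : ℝ} (hτ : τ ∈ Set.Icc (0 : ℝ) 1) :
    CalDPDual Q N ((1 - τ) * tvDist (groupLaw Q 0) (groupLaw Q 1) + 1 / N)
      (τ * tvDist (groupLaw Q 0) (groupLaw Q 1)) := by
  have hp0 := isProbabilityMeasure_groupLaw (hQ 0)
  have hp1 := isProbabilityMeasure_groupLaw (hQ 1)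
  obtain ⟨K, hK⟩ := exists_norm_calDPVec_le Q N
  intro u Λ hΛ0 hΛ hu
  set D := tvDist (groupLaw Q 0) (groupLaw Q 1)
  set w := u (Sum.inr 0) with hw
  set g := calDPGame Q N (Prod.fst : X × Fin 2 → X) measurable_fst
  have hN' : (0 : ℝ) < N := by exact_mod_cast hN
  have hval := g.integrable_gameValue_meanPayoff (fun r => hK r.1.2 r.2.1 r.2.2) u
  have hval' : Integrable (fun x => gameValue (g.meanPayoff u x)) Q.fst := hval
  refine le_of_forall_pos_le_add fun η hη => ?_
  obtain ⟨P, hPm, hP⟩ := exists_measurable_column_strategy (A := Fin N) (B := Fin 2) hη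
  let q : X → ℝ := fun x => P (g.meanPayoff u x) 1
  have hPx : Measurable (fun x => P (g.meanPayoff u x)) :=
    hPm.comp (g.measurable_meanPayoff.comp
      (g := fun p : EuclideanSpace ℝ (CalIdx N) × X => g.meanPayoff p.1 p.2)
      (f := fun x : X => (u, x)) measurable_prodMk_left)
  have hqm : Measurable q :=
    (measurable_pi_apply (1 : Fin 2)).comp (measurable_subtype_coe.comp hPx)
  have hq01 : ∀ x, q x ∈ Set.Icc (0 : ℝ) 1 := fun x => by
    have h := (P (g.meanPayoff u x)).2
    exact ⟨h.1 1, (Finset.single_le_sum (fun b _ => h.1 b) (Finset.mem_univ 1)).trans h.2.le⟩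
  have hqL : ∀ x, |q x| ≤ 1 := fun x => by
    rw [abs_of_nonneg (hq01 x).1]; exact (hq01 x).2
  have hPk : ∀ x k, gameValue (g.meanPayoff u x) - η ≤ ∑ s, groupDensity Q s x *
      (u (Sum.inl (s, k)) * (gridPoint N k - q x) + u (Sum.inr s) * gridPoint N k) := fun x k => by
    exact (hP (g.meanPayoff u x) k).le.trans_eq
      (sum_mul_meanPayoff_calDPGame (P (g.meanPayoff u x)).2 u x k)
  -- Any reply of the Player to `q` bounds the value up to `η`; integrating against the densities
  -- turns this bound into integrals over the two group laws.
  have hbound : ∀ {F : Fin 2 → X → ℝ} {L : ℝ}, (∀ s, Measurable (F s)) → (∀ s x, |F s x| ≤ L) →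
      (∀ x, gameValue (g.meanPayoff u x) - η ≤ ∑ s, groupDensity Q s x * F s x) →
      ∫ x, gameValue (g.meanPayoff u x) ∂Q.fst ≤ ∑ s, ∫ x, F s x ∂(groupLaw Q s) + η := by
    intro F L hF hL hle
    have hsub : Integrable (fun x => gameValue (g.meanPayoff u x) - η) Q.fst :=
      hval'.sub (integrable_const η)
    have h := integral_mono hsub (integrable_sum_groupDensity_mul hQ hF hL) hle
    rw [integral_sum_groupDensity_mul hQ hF hL, integral_sub hval' (integrable_const η)] at h
    simp only [integral_const, probReal_univ, one_smul] at h
    linarith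
  have hint : ∀ (μ : Measure X) [IsProbabilityMeasure μ] {f : X → ℝ}, Measurable f →
      (∀ x, f x ∈ Set.Icc (0 : ℝ) 1) → Integrable f μ := fun μ _ f hf hf01 =>
    Integrable.of_bound hf.aestronglyMeasurable 1 (ae_of_all _ fun x => by
      rw [Real.norm_of_nonneg (hf01 x).1]; exact (hf01 x).2)
  -- Reply by rounding: each group pays Λ/(2N) for calibration. The mean forecast is the explicit
  -- measurable [0, 1]-valued function `clipGrid N (q x)`, so its group means differ by at most `D`.
  have hround : ∫ x, gameValue (g.meanPayoff u x) ∂Q.fst ≤ 1 / N * Λ + D * |w| + η := by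
    have hcm : Measurable fun x => clipGrid N (q x) := measurable_clipGrid.comp hqm
    have hc01 : ∀ x, clipGrid N (q x) ∈ Set.Icc (0 : ℝ) 1 := fun x => clipGrid_mem_Icc hN _
    have hF := hbound (F := fun s x => Λ * (1 / (2 * N)) + u (Sum.inr s) * clipGrid N (q x))
      (L := Λ * (1 / (2 * N)) + |w|) (fun s => (hcm.const_mul _).const_add _)
      (fun s x => by
        refine (abs_add_le _ _).trans (add_le_add (abs_of_nonneg (by positivity)).le ?_)
        rw [abs_mul, abs_of_nonneg (hc01 x).1]
        refine (mul_le_of_le_one_right (abs_nonneg _) (hc01 x).2).trans (le_of_eq ?_)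
        fin_cases s
        · rfl
        · simp [hu])
      (fun x => by
        obtain ⟨i, j, θ, hθ, hθ1, hθ2⟩ := exists_rounding hN (hq01 x)
        have hmix : gameValue (g.meanPayoff u x) - η ≤
            (1 - θ) * (∑ s, groupDensity Q s x * (u (Sum.inl (s, i)) * (gridPoint N i - q x) +
              u (Sum.inr s) * gridPoint N i)) +
            θ * (∑ s, groupDensity Q s x * (u (Sum.inl (s, j)) * (gridPoint N j - q x) +
              u (Sum.inr s) * gridPoint N j)) := by
          nlinarith [mul_le_mul_of_nonneg_left (hPk x i) (sub_nonneg.2 hθ.2),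
            mul_le_mul_of_nonneg_left (hPk x j) hθ.1]
        refine hmix.trans ?_
        rw [Finset.mul_sum, Finset.mul_sum, ← Finset.sum_add_distrib]
        refine Finset.sum_le_sum fun s _ => ?_
        have hle : ∀ k, u (Sum.inl (s, k)) * (gridPoint N k - q x) ≤
            Λ * |gridPoint N k - q x| := fun k => (le_abs_self _).trans (by
          rw [abs_mul]; exact mul_le_mul_of_nonneg_right (hΛ _) (abs_nonneg _))
        have hi := mul_le_mul_of_nonneg_left (hle i) (sub_nonneg.2 hθ.2)
        have hj := mul_le_mul_of_nonneg_left (hle j) hθ.1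
        have hk := mul_le_mul_of_nonneg_left hθ2 hΛ0
        calc _ = groupDensity Q s x * ((1 - θ) * (u (Sum.inl (s, i)) * (gridPoint N i - q x)) +
              θ * (u (Sum.inl (s, j)) * (gridPoint N j - q x)) +
              u (Sum.inr s) * ((1 - θ) * gridPoint N i + θ * gridPoint N j)) := by ring
          _ ≤ _ := by
            rw [hθ1]
            exact mul_le_mul_of_nonneg_left (by linarith) (groupDensity_nonneg Q s x))
    have hI : ∀ s, ∫ x, (Λ * (1 / (2 * N)) + u (Sum.inr s) * clipGrid N (q x)) ∂(groupLaw Q s) =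
        Λ * (1 / (2 * N)) + u (Sum.inr s) * ∫ x, clipGrid N (q x) ∂(groupLaw Q s) := fun s => by
      have := isProbabilityMeasure_groupLaw (hQ s)
      rw [integral_add (integrable_const _) ((hint _ hcm hc01).const_mul _), integral_const,
        integral_const_mul]
      simp
    simp only [hI, Fin.sum_univ_two, hu, ← hw] at hF
    have htv := abs_integral_sub_integral_le_tvDist (groupLaw Q 0) (groupLaw Q 1) hcm hc01
    have hmul : w * ((∫ x, clipGrid N (q x) ∂(groupLaw Q 0)) -
        ∫ x, clipGrid N (q x) ∂(groupLaw Q 1)) ≤ D * |w| := by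
      refine (le_abs_self _).trans ?_
      rw [abs_mul, mul_comm]
      exact mul_le_mul_of_nonneg_right htv (abs_nonneg _)
    have hΛN : Λ * (1 / (2 * N)) + Λ * (1 / (2 * N)) = 1 / N * Λ := by field_simp; ring
    linarith
  -- Reply by a constant forecast near the mean of `q` over group 0: the parity terms cancel, group
  -- 0 pays 1/(2N) and group 1 pays 1/(2N) + D, times Λ.
  have hconst : ∫ x, gameValue (g.meanPayoff u x) ∂Q.fst ≤ (D + 1 / N) * Λ + η := by
    have hm01 : ∫ x, q x ∂(groupLaw Q 0) ∈ Set.Icc (0 : ℝ) 1 :=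
      ⟨integral_nonneg fun x => (hq01 x).1, by
        have := integral_mono (hint (groupLaw Q 0) hqm hq01) (integrable_const 1)
          fun x => (hq01 x).2
        simpa using this⟩
    obtain ⟨k, hk⟩ := exists_abs_gridPoint_sub_le hN hm01
    obtain ⟨L, hL⟩ : ∃ L, ∀ s, |u (Sum.inl (s, k)) * gridPoint N k + u (Sum.inr s) *
        gridPoint N k| + |u (Sum.inl (s, k))| ≤ L := by
      obtain ⟨L, hL⟩ := (Set.finite_range fun s : Fin 2 => |u (Sum.inl (s, k)) * gridPoint N k +
        u (Sum.inr s) * gridPoint N k| + |u (Sum.inl (s, k))|).bddAbove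
      exact ⟨L, fun s => hL ⟨s, rfl⟩⟩
    have hF := hbound (F := fun s x => u (Sum.inl (s, k)) * (gridPoint N k - q x) +
        u (Sum.inr s) * gridPoint N k) (L := L)
      (fun s => ((hqm.const_sub _).const_mul _).add_const _)
      (fun s x => by
        refine le_trans ?_ (hL s)
        rw [show u (Sum.inl (s, k)) * (gridPoint N k - q x) + u (Sum.inr s) * gridPoint N k =
          (u (Sum.inl (s, k)) * gridPoint N k + u (Sum.inr s) * gridPoint N k) -
            u (Sum.inl (s, k)) * q x by ring]
        refine (abs_sub _ _).trans (add_le_add le_rfl ?_)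
        rw [abs_mul]
        exact mul_le_of_le_one_right (abs_nonneg _) (hqL x))
      fun x => hPk x k
    have hI : ∀ s, ∫ x, (u (Sum.inl (s, k)) * (gridPoint N k - q x) +
        u (Sum.inr s) * gridPoint N k) ∂(groupLaw Q s) =
        u (Sum.inl (s, k)) * (gridPoint N k - ∫ x, q x ∂(groupLaw Q s)) +
          u (Sum.inr s) * gridPoint N k := fun s => by
      have := isProbabilityMeasure_groupLaw (hQ s)
      have hqi := hint (groupLaw Q s) hqm hq01
      have hsub : Integrable (fun x => gridPoint N k - q x) (groupLaw Q s) :=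
        (integrable_const _).sub hqi
      rw [integral_add (hsub.const_mul _) (integrable_const _), integral_const_mul,
        integral_sub (integrable_const _) hqi]
      simp
    simp only [hI, Fin.sum_univ_two, hu, ← hw] at hF
    have htv := abs_integral_sub_integral_le_tvDist (groupLaw Q 0) (groupLaw Q 1) hqm hq01
    have h1 : |gridPoint N k - ∫ x, q x ∂(groupLaw Q 1)| ≤ 1 / (2 * N) + D :=
      (abs_sub_le _ _ _).trans (add_le_add hk htv)
    have hmul : ∀ (s : Fin 2) (y c : ℝ), |y| ≤ c → u (Sum.inl (s, k)) * y ≤ Λ * c :=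
      fun s y c hy => (le_abs_self _).trans (by
        rw [abs_mul]; exact mul_le_mul (hΛ _) hy (abs_nonneg _) hΛ0)
    have h2 := hmul 0 _ _ hk
    have h3 := hmul 1 _ _ h1
    have hΛN : Λ * (1 / (2 * N)) + Λ * (1 / (2 * N) + D) = (D + 1 / N) * Λ := by field_simp; ring
    linarith
  change ∫ x, gameValue (g.meanPayoff u x) ∂Q.fst ≤ _
  -- Both estimates bound the same value, so their convex combination with weights τ and 1 - τ does
  -- too.
  calc ∫ x, gameValue (g.meanPayoff u x) ∂Q.fst
      = τ * ∫ x, gameValue (g.meanPayoff u x) ∂Q.fst +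
        (1 - τ) * ∫ x, gameValue (g.meanPayoff u x) ∂Q.fst := by ring
    _ ≤ τ * (1 / N * Λ + D * |w| + η) + (1 - τ) * ((D + 1 / N) * Λ + η) :=
        add_le_add (mul_le_mul_of_nonneg_left hround hτ.1)
          (mul_le_mul_of_nonneg_left hconst (sub_nonneg.2 hτ.2))
    _ = _ := by ring

end CalibrationBounds

theorem proposition3 {X : Type*} [MeasurableSpace X] (Q : Measure (X × Fin 2))
    [IsProbabilityMeasure Q] (hQ : ∀ s : Fin 2, 0 < groupProb Q s) (N : ℕ) (hN : 2 ≤ N) :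
    (∀ τ ∈ Set.Icc (0 : ℝ) 1,
      IsLeast {ε : ℝ | Achievable Q N (Prod.fst : X × Fin 2 → X) measurable_fst ε
          (τ * tvDist (groupLaw Q 0) (groupLaw Q 1))}
        (epsStar Q N (Prod.fst : X × Fin 2 → X) measurable_fst
          (τ * tvDist (groupLaw Q 0) (groupLaw Q 1))) ∧
      (1 - τ) * tvDist (groupLaw Q 0) (groupLaw Q 1) ≤
        epsStar Q N (Prod.fst : X × Fin 2 → X) measurable_fst
          (τ * tvDist (groupLaw Q 0) (groupLaw Q 1)) ∧
      epsStar Q N (Prod.fst : X × Fin 2 → X) measurable_fst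
          (τ * tvDist (groupLaw Q 0) (groupLaw Q 1)) ≤
        (1 - τ) * tvDist (groupLaw Q 0) (groupLaw Q 1) + 1 / N) ∧
    Achievable Q N (Prod.fst : X × Fin 2 → X) measurable_fst (1 / N)
      (tvDist (groupLaw Q 0) (groupLaw Q 1)) := by
  have hN0 : 0 < N := by omega
  have hne : Nonempty (Fin N) := ⟨⟨0, hN0⟩⟩
  have hp0 := isProbabilityMeasure_groupLaw (hQ 0)
  have hp1 := isProbabilityMeasure_groupLaw (hQ 1)
  have hD := tvDist_nonneg (groupLaw Q 0) (groupLaw Q 1)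
  have hach : ∀ τ ∈ Set.Icc (0 : ℝ) 1, Achievable Q N (Prod.fst : X × Fin 2 → X) measurable_fst
      ((1 - τ) * tvDist (groupLaw Q 0) (groupLaw Q 1) + 1 / N)
      (τ * tvDist (groupLaw Q 0) (groupLaw Q 1)) := fun τ hτ =>
    achievable_iff.2 ⟨add_nonneg (mul_nonneg (sub_nonneg.2 hτ.2) hD) (by positivity),
      mul_nonneg hτ.1 hD, calDPDual_of_mem_Icc hQ hN0 hτ⟩
  refine ⟨fun τ hτ => ?_, by simpa using hach 1 ⟨zero_le_one, le_rfl⟩⟩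
  have hbdd : BddBelow {ε : ℝ | Achievable Q N (Prod.fst : X × Fin 2 → X) measurable_fst ε
      (τ * tvDist (groupLaw Q 0) (groupLaw Q 1))} := ⟨0, fun ε hε => hε.1⟩
  -- The infimum is attained, so the lower bound can be read off from achievability at `epsStar`
  -- itself.
  have hmem := (isClosed_setOf_achievable _).csInf_mem ⟨_, hach τ hτ⟩ hbdd
  refine ⟨⟨hmem, fun ε hε => csInf_le hbdd hε⟩, ?_, csInf_le hbdd (hach τ hτ)⟩
  have hlow := tvDist_le_of_calDPDual hQ (achievable_iff.1 hmem).2.2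
  rw [epsStar]
  linarith
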